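/- Let $\Sigma$ be a finite alphabet. For $L\subseteq\Sigma^*$ let $f_L(n)$ be the number of words of length $n$ in $L$. The generating series of $L$ is $\sum_{w\in L}x^{|w|}=\sum_n f_L(n)x^n$. A series in $\mathbb N[[x]]$ is called rational if it belongs to the smallest class that contains the polynomials with coefficients in $\mathbb N$ and is closed under sum, product, and star $s\mapsto s^*=1+s+s^2+\cdots$ ($s$ without constant term). $L$ is called counting regular if there is a regular language $R$, over some finite alphabet, with $f_R=f_L$. A matrix grammar $G=(N,\Sigma,M,S)$ has finite disjoint sets $N$, $\Sigma$ of nonterminals and terminals, a start symbol $S\in N$, and a finite set $M$ of matrices, i.e. finite sequences $m=(p_1,\dots,p_s)$ of context-free productions; $x\Rightarrow_m y$ means that $y$ arises from $x$ by applying $p_1,\dots,p_s$ in this order, each to some occurrence of its left-hand side. A derivation of $w\in\Sigma^*$ is a sequence $S=x_0\Rightarrow_{m_1}x_1\Rightarrow_{m_2}\cdots\Rightarrow_{m_s}x_s=w$ with $m_i\in M$, determined by the matrices $m_i$ and the sentential forms $x_i$; its index is the maximal number of occurrences of nonterminals in one of the $x_i$. $L(G)$ is the set of words that have a derivation. $G$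 is unambiguous if every word of $L(G)$ has exactly one derivation, and of finite index if there is $k$ such that every word of $L(G)$ has a derivation of index at most $k$. A reduced ET0L system $G=(V,\mathcal P,S,\Sigma)$ has finite disjoint sets $V$, $\Sigma$ of variables and terminals, an axiom $S\in V$, and a finite set $\mathcal P$ of tables, each a finite set of productions $X\to\alpha$ with $X\in V$, $\alpha\in(V\cup\Sigma)^*$; in a derivation step $x\Rightarrow y$, all occurrences of variables in $x$ are rewritten in parallel by productions of one table, and terminals are kept. $L(G)$ is the set of $w\in\Sigma^*$ with $S\Rightarrow^* w$. A derivation tree of $w$ is a finite ordered tree with root $S$, leaves labelled by terminals or $\lambda$, inner nodes labelled by variables, and yield $w$, such that for each depth there is one table of $\mathcal P$ by whose productions all inner nodes of that depth are expanded (the tables are not part of the tree). $G$ is unambiguous if every word of $L(G)$ has exactly one derivation tree. $G$ is of finite index if there is $k$ such that every word of $L(G)$ has a derivation from $S$ all of whose sentential forms contain at most $k$ occurrences of variables. Theorem. If $L$ is the language generated by an unambiguous matrix grammar of finite index, then the generating series of $L$ is rational, and $L$ is counting regular. If $L$ is the language generated by an unambiguous reduced ET0L system of finite index, then the generating series of $L$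 is rational, and $L$ is counting regular. -/

import Mathlib

/-! ### Counting functions, generating series, rationality -/

/-- The counting function of a language: the number of its words of length `n`. -/
noncomputable def countingFunction {T : Type*} (L : Language T) (n : ℕ) : ℕ :=
  Set.ncard {w : List T | w ∈ L ∧ w.length = n}

/-- The generating series `∑_{w ∈ L} X ^ |w|` of a language over a finite alphabet. -/
noncomputable def generatingSeries {T : Type*} (L : Language T) : PowerSeries ℕ :=
  PowerSeries.mk (countingFunction L)

/-- Rational series in one variable with multiplicities in `ℕ`: the smallest class containing the
polynomials and closed under sum, product and star. The star of a series `f` without constant term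
is `f* = 1 + f + f ^ 2 + ⋯`, the only series `g` with `g = 1 + f * g`. -/
inductive IsRationalSeries : PowerSeries ℕ → Prop
  | polynomial (p : Polynomial ℕ) : IsRationalSeries (p : PowerSeries ℕ)
  | add {f g : PowerSeries ℕ} :
      IsRationalSeries f → IsRationalSeries g → IsRationalSeries (f + g)
  | mul {f g : PowerSeries ℕ} :
      IsRationalSeries f → IsRationalSeries g → IsRationalSeries (f * g)
  | star {f g : PowerSeries ℕ} :
      IsRationalSeries f → PowerSeries.constantCoeff f = 0 → g = 1 + f * g → IsRationalSeries g

/-- A language is counting regular if some regular language, over some finite alphabet, has the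
same counting function. -/
def IsCountingRegular {T : Type*} (L : Language T) : Prop :=
  ∃ (m : ℕ) (R : Language (Fin m)), R.IsRegular ∧ countingFunction R = countingFunction L

/-! ### Sentential forms -/

/-- The number `|x|_N` of occurrences of nonterminals in a sentential form. -/
def numNonterminals {T N : Type*} : List (Symbol T N) → ℕ
  | [] => 0
  | Symbol.terminal _ :: x => numNonterminals x
  | Symbol.nonterminal _ :: x => numNonterminals x + 1

/-- The index of a sequence of sentential forms: the maximal number of occurrences of
nonterminals in one of them. -/
def indexOfForms {T N : Type*} (xs : List (List (Symbol T N))) : ℕ :=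
  (xs.map numNonterminals).foldr max 0

/-! ### Matrix grammars -/

/-- A (context-free) matrix grammar with terminals `T` and nonterminals `N`. A matrix rule is a
finite sequence of context-free productions. -/
structure MatrixGrammar (T N : Type*) where
  /-- the start symbol -/
  initial : N
  /-- the finite set of matrix rules -/
  rules : Finset (List (ContextFreeRule T N))

namespace MatrixGrammar

variable {T N : Type*}

/-- `x ⇒_m y`: the productions of the matrix `m` are applied one after another, in order, each to
an arbitrary occurrence of its left-hand side. -/
inductive Step : List (ContextFreeRule T N) → List (Symbol T N) → List (Symbol T N) → Prop
  | nil (x : List (Symbol T N)) : Step [] x x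
  | cons {p : ContextFreeRule T N} {m : List (ContextFreeRule T N)} {x y z : List (Symbol T N)} :
      p.Rewrites x y → Step m y z → Step (p :: m) x z

/-- `G.IsDerivation x [(m₁, x₁), …, (mₛ, xₛ)] y`: the sequence
`x ⇒_{m₁} x₁ ⇒_{m₂} ⋯ ⇒_{mₛ} xₛ = y` is a derivation of `y` from `x` in `G`
(and `y = x` when `s = 0`). -/
inductive IsDerivation (G : MatrixGrammar T N) :
    List (Symbol T N) → List (List (ContextFreeRule T N) × List (Symbol T N)) →
      List (Symbol T N) → Prop
  | nil (x : List (Symbol T N)) : IsDerivation G x [] x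
  | cons {m : List (ContextFreeRule T N)} {x y z : List (Symbol T N)}
      {d : List (List (ContextFreeRule T N) × List (Symbol T N))} :
      m ∈ G.rules → Step m x y → IsDerivation G y d z → IsDerivation G x ((m, y) :: d) z

/-- `d` is a derivation of the terminal word `w` from the start symbol. -/
def IsDerivationOf (G : MatrixGrammar T N)
    (d : List (List (ContextFreeRule T N) × List (Symbol T N))) (w : List T) : Prop :=
  G.IsDerivation [Symbol.nonterminal G.initial] d (w.map Symbol.terminal)

/-- The language generated by `G`. -/
def language (G : MatrixGrammar T N) : Language T :=
  {w : List T | ∃ d, G.IsDerivationOf d w}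

/-- Every word of the language has exactly one derivation. Derivations are distinguished by their
matrices and their sentential forms. -/
def IsUnambiguous (G : MatrixGrammar T N) : Prop :=
  ∀ w ∈ G.language, ∃! d, G.IsDerivationOf d w

/-- The index of a derivation from the start symbol: the maximal number of occurrences of
nonterminals in its sentential forms (the start symbol included). -/
def derivationIndex (G : MatrixGrammar T N)
    (d : List (List (ContextFreeRule T N) × List (Symbol T N))) : ℕ :=
  indexOfForms ([Symbol.nonterminal G.initial] :: d.map Prod.snd)

/-- `G` is of finite index: for some `k`, every word of the language has a derivation of index
at most `k`. -/
def IsFiniteIndex (G : MatrixGrammar T N) : Prop :=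
  ∃ k : ℕ, ∀ w ∈ G.language, ∃ d, G.IsDerivationOf d w ∧ G.derivationIndex d ≤ k

end MatrixGrammar

/-! ### Reduced ET0L systems -/

/-- A reduced ET0L system with terminals `T` and (disjoint from them) variables `V`: a finite set
of tables, each a finite set of productions `X → α` with `X` in `V` and `α` a word over
`V ∪ T`. -/
structure ReducedET0L (T V : Type*) where
  /-- the axiom -/
  initial : V
  /-- the finite set of production tables -/
  tables : Finset (Finset (ContextFreeRule T V))

/-- Finite ordered trees with inner nodes labelled by variables and leaves labelled by terminals;
an inner node without children stands for the application of a production `X → λ`. -/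
inductive ET0LTree (T V : Type*) : Type _
  | leaf (a : T) : ET0LTree T V
  | node (X : V) (children : List (ET0LTree T V)) : ET0LTree T V

namespace ET0LTree

variable {T V : Type*}

/-- The label of the root. -/
def root : ET0LTree T V → Symbol T V
  | leaf a => Symbol.terminal a
  | node X _ => Symbol.nonterminal X

/-- The yield: the word of terminals at the leaves, read from left to right. -/
def yield : ET0LTree T V → List T
  | leaf a => [a]
  | node _ ts => (ts.map yield).flatten

/-- `Follows [P₁, …, Pₕ] t`: every inner node of `t` of depth `i` (the root has depth `0`) is
expanded by a production of the table `Pᵢ₊₁`; terminals are not expanded. -/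
inductive Follows : List (Finset (ContextFreeRule T V)) → ET0LTree T V → Prop
  | leaf (Ps : List (Finset (ContextFreeRule T V))) (a : T) : Follows Ps (leaf a)
  | node {P : Finset (ContextFreeRule T V)} {Ps : List (Finset (ContextFreeRule T V))}
      {X : V} {ts : List (ET0LTree T V)} :
      ContextFreeRule.mk X (ts.map root) ∈ P → (∀ t ∈ ts, Follows Ps t) →
        Follows (P :: Ps) (node X ts)

end ET0LTree

namespace ReducedET0L

variable {T V : Type*}

/-- `x ⇒_P y`: every variable occurring in `x` is replaced, in parallel, by the right-hand side
of one of its productions in the table `P`; the terminals are kept. -/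
inductive Step (P : Finset (ContextFreeRule T V)) :
    List (Symbol T V) → List (Symbol T V) → Prop
  | nil : Step P [] []
  | terminal {x y : List (Symbol T V)} (a : T) :
      Step P x y → Step P (Symbol.terminal a :: x) (Symbol.terminal a :: y)
  | nonterminal {x y : List (Symbol T V)} {X : V} {α : List (Symbol T V)} :
      ContextFreeRule.mk X α ∈ P → Step P x y → Step P (Symbol.nonterminal X :: x) (α ++ y)

/-- `G.IsDerivation x [x₁, …, xₛ] y`: the sequence `x ⇒ x₁ ⇒ ⋯ ⇒ xₛ = y` is a derivation of
`y` from `x` in `G` (and `y = x` when `s = 0`). -/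
inductive IsDerivation (G : ReducedET0L T V) :
    List (Symbol T V) → List (List (Symbol T V)) → List (Symbol T V) → Prop
  | nil (x : List (Symbol T V)) : IsDerivation G x [] x
  | cons {P : Finset (ContextFreeRule T V)} {x y z : List (Symbol T V)}
      {d : List (List (Symbol T V))} :
      P ∈ G.tables → Step P x y → IsDerivation G y d z → IsDerivation G x (y :: d) z

/-- `d` is a derivation of the terminal word `w` from the axiom. -/
def IsDerivationOf (G : ReducedET0L T V) (d : List (List (Symbol T V))) (w : List T) : Prop :=
  G.IsDerivation [Symbol.nonterminal G.initial] d (w.map Symbol.terminal)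

/-- The language generated by `G`. -/
def language (G : ReducedET0L T V) : Language T :=
  {w : List T | ∃ d, G.IsDerivationOf d w}

/-- `t` is a derivation tree of the terminal word `w` in `G`: its root is the axiom, its yield is
`w`, and there is a sequence of tables of `G` such that all variables of the same depth are
expanded by productions of the same table of the sequence. -/
def IsDerivationTreeOf (G : ReducedET0L T V) (t : ET0LTree T V) (w : List T) : Prop :=
  t.root = Symbol.nonterminal G.initial ∧ t.yield = w ∧
    ∃ Ps : List (Finset (ContextFreeRule T V)), (∀ P ∈ Ps, P ∈ G.tables) ∧ t.Follows Ps

/-- Every word of the language has exactly one derivation tree. -/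
def IsUnambiguous (G : ReducedET0L T V) : Prop :=
  ∀ w ∈ G.language, ∃! t, G.IsDerivationTreeOf t w

/-- The index of a derivation from the axiom: the maximal number of occurrences of variables in
its sentential forms (the axiom included). -/
def derivationIndex (G : ReducedET0L T V) (d : List (List (Symbol T V))) : ℕ :=
  indexOfForms ([Symbol.nonterminal G.initial] :: d)

/-- `G` is of finite index: for some `k`, every word of the language has a derivation of index
at most `k`. -/
def IsFiniteIndex (G : ReducedET0L T V) : Prop :=
  ∃ k : ℕ, ∀ w ∈ G.language, ∃ d, G.IsDerivationOf d w ∧ G.derivationIndex d ≤ k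

end ReducedET0L

/-! Derivations of index at most `k` are paths in an infinite transition system: the configurations
are the sentential forms with at most `k` nonterminals, and a step weighs the number of terminals it
adds. By finite index and unambiguity these paths correspond one to one to the words of the
language, the weight of a path being the length of its word. The generating series therefore counts
paths by weight.

Only finitely much of a form matters for this count. A step fills the nonterminals with words, and
which fillings are possible depends on the sequence of nonterminals alone. A derivation tree of an
ET0L system records the fillings, so forms with the same variables have corresponding paths.
Derivations of a matrix grammar are told apart by their forms, so it also matters which fillings of
a form coincide. This is decided by the solutions, of bounded length, of the equations `a u = u b`
for the terminal words `u` between the nonterminals (`FormEquiv.fill_eq`). The resulting equivalence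
has finite index (`exists_finite_index_formEquiv`).

A bisimulation of finite index turns the count into a finite linear system over `ℕ[[X]]` with
polynomial coefficients. Elimination by Arden's lemma keeps the solution rational if the constant
terms of the coefficients have no cycle (`IsRationalSeries.of_linear_system`). They have none
because paths of a given weight have bounded length (`PathSystem.rank_lt`).

A rational series lies in a finitely generated `ℕ`-module of series stable under the shift, that is,
an automaton with multiplicities. Giving parallel transitions different letters makes it
deterministic, and a constant term at most `1`, as every language has, makes acceptance of the empty
word a yes-no matter. -/

/-! ### Rational series as counting functions of regular languages -/

namespace PowerSeries

/-- The left shift of the sequence of coefficients. -/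
noncomputable def shift : PowerSeries ℕ →ₗ[ℕ] PowerSeries ℕ where
  toFun f := mk fun n => coeff (n + 1) f
  map_add' f g := by ext; simp
  map_smul' a f := by ext; simp [-nsmul_eq_mul, -smul_eq_mul, map_nsmul]

@[simp]
theorem coeff_shift (n : ℕ) (f : PowerSeries ℕ) : coeff n (shift f) = coeff (n + 1) f := by
  simp [shift]

/-- The analogue of the rule for the left quotient of a product of languages by a letter; it yields
stability under the shift for products and stars. -/
theorem shift_mul (f g : PowerSeries ℕ) :
    shift (f * g) = shift f * g + constantCoeff f • shift g := by
  ext n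
  rw [coeff_shift, coeff_mul, Finset.Nat.antidiagonal_succ, Finset.sum_cons, Finset.sum_map,
    map_add, coeff_mul, map_smul, coeff_shift, add_comm]
  simp

theorem shift_one : shift 1 = 0 := by
  ext n
  simp [coeff_one]

/-- Membership in a finitely generated module of series that is stable under the shift. -/
def IsRecognizable (f : PowerSeries ℕ) : Prop :=
  ∃ S : Set (PowerSeries ℕ), S.Finite ∧ (∀ g ∈ S, shift g ∈ Submodule.span ℕ S) ∧
    f ∈ Submodule.span ℕ S

theorem shift_mem_span {S : Set (PowerSeries ℕ)} (h : ∀ g ∈ S, shift g ∈ Submodule.span ℕ S)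
    {f : PowerSeries ℕ} (hf : f ∈ Submodule.span ℕ S) : shift f ∈ Submodule.span ℕ S :=
  (Submodule.span_le (p := (Submodule.span ℕ S).comap shift)).2 h hf

theorem mul_mem_span_image {S : Set (PowerSeries ℕ)} {f : PowerSeries ℕ}
    (hf : f ∈ Submodule.span ℕ S) (g : PowerSeries ℕ) :
    f * g ∈ Submodule.span ℕ ((· * g) '' S) :=
  (Submodule.span_le (p := (Submodule.span ℕ ((· * g) '' S)).comap (LinearMap.mulRight ℕ g))).2
    (fun s hs => Submodule.subset_span ⟨s, hs, rfl⟩) hf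

end PowerSeries

open PowerSeries

theorem IsRationalSeries.isRecognizable {f : PowerSeries ℕ} (hf : IsRationalSeries f) :
    f.IsRecognizable := by
  induction hf with
  | polynomial p =>
    refine ⟨(fun n => X ^ n) '' (Finset.range (p.natDegree + 1) : Set ℕ),
      (Finset.finite_toSet _).image _, ?_, ?_⟩
    · rintro _ ⟨n, hn, rfl⟩
      rcases n with _ | n
      · simp [shift_one]
      · have : shift (X ^ (n + 1)) = X ^ n := by
          ext k
          simp [coeff_X_pow]
        dsimp only
        rw [this]
        refine Submodule.subset_span ⟨n, ?_, rfl⟩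
        simp only [Finset.coe_range, Set.mem_Iio] at hn ⊢
        omega
    · have : (p : PowerSeries ℕ) = ∑ i ∈ Finset.range (p.natDegree + 1), p.coeff i • X ^ i := by
        ext k
        simp only [Polynomial.coeff_coe, map_sum, map_nsmul, coeff_X_pow, smul_eq_mul, mul_ite,
          mul_one, mul_zero, Finset.sum_ite_eq, Finset.mem_range]
        split_ifs with h
        · rfl
        · exact Polynomial.coeff_eq_zero_of_natDegree_lt (by omega)
      rw [this]
      exact Submodule.sum_mem _ fun i hi => Submodule.smul_mem _ _
        (Submodule.subset_span ⟨i, by simpa using hi, rfl⟩)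
  | add _ _ hf hg =>
    obtain ⟨S, hS, hS', hf⟩ := hf
    obtain ⟨S₂, hS₂, hS₂', hg⟩ := hg
    have h1 := Submodule.span_mono (R := ℕ) (Set.subset_union_left (s := S) (t := S₂))
    have h2 := Submodule.span_mono (R := ℕ) (Set.subset_union_right (s := S) (t := S₂))
    exact ⟨S ∪ S₂, hS.union hS₂, fun g hg => hg.elim (fun h => h1 (hS' g h))
      (fun h => h2 (hS₂' g h)), Submodule.add_mem _ (h1 hf) (h2 hg)⟩
  | @mul f g _ _ hf hg =>
    obtain ⟨S, hS, hS', hf⟩ := hf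
    obtain ⟨S₂, hS₂, hS₂', hg⟩ := hg
    have h1 := Submodule.span_mono (R := ℕ)
      (Set.subset_union_left (s := (· * g) '' S) (t := S₂))
    have h2 := Submodule.span_mono (R := ℕ)
      (Set.subset_union_right (s := (· * g) '' S) (t := S₂))
    refine ⟨(· * g) '' S ∪ S₂, (hS.image _).union hS₂, ?_, h1 (mul_mem_span_image hf g)⟩
    rintro _ (⟨s, hs, rfl⟩ | h)
    · dsimp only
      rw [shift_mul]
      exact Submodule.add_mem _ (h1 (mul_mem_span_image (hS' s hs) g))
        (Submodule.smul_mem _ _ (h2 (shift_mem_span hS₂' hg)))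
    · exact h2 (hS₂' _ h)
  | @star f g _ h0 hg hf =>
    obtain ⟨S, hS, hS', hf⟩ := hf
    have h1 := Submodule.span_mono (R := ℕ) (Set.subset_insert g ((· * g) '' S))
    -- Since `f` has no constant term, the shift of the star is a combination of the `s * g` with
    -- `s` in `S`; `g` itself is the only further generator.
    have h2 : shift g = shift f * g := by
      conv_lhs => rw [hg]
      rw [map_add, shift_one, shift_mul, h0, zero_smul, add_zero, zero_add]
    have h3 : shift g ∈ Submodule.span ℕ (insert g ((· * g) '' S)) := by
      rw [h2]
      exact h1 (mul_mem_span_image (shift_mem_span hS' hf) g)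
    refine ⟨insert g ((· * g) '' S), (hS.image _).insert _, ?_,
      Submodule.subset_span (Set.mem_insert _ _)⟩
    rintro _ (rfl | ⟨s, hs, rfl⟩)
    · exact h3
    · dsimp only
      rw [shift_mul]
      exact Submodule.add_mem _ (h1 (mul_mem_span_image (hS' s hs) g))
        (Submodule.smul_mem _ _ h3)

/-- A finite family of series with constant terms at most `1` that is stable under the shift
consists of generating series of regular languages. -/
theorem exists_isRegular_of_shift_eq {ι : Type} [Fintype ι] (G : ι → PowerSeries ℕ)
    (M : ι → ι → ℕ) (h0 : ∀ i, constantCoeff (G i) ≤ 1)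
    (hG : ∀ i, shift (G i) = ∑ j, M i j • G j) (i : ι) :
    ∃ (m : ℕ) (R : Language (Fin m)), R.IsRegular ∧
      ∀ n, countingFunction R n = coeff n (G i) := by
  classical
  -- One letter for each of the `M i j` parallel transitions from `i` to `j`. A letter determines
  -- its source and target, so the automaton is deterministic; `none` is the sink for letters with
  -- another source.
  let A := Σ p : ι × ι, Fin (M p.1 p.2)
  let e : A ≃ Fin (Fintype.card A) := Fintype.equivFin A
  let D : DFA (Fin (Fintype.card A)) (Option ι) :=
    { step := fun s a => if s = some (e.symm a).1.1 then some (e.symm a).1.2 else none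
      start := some i
      accept := {s | ∃ i, s = some i ∧ constantCoeff (G i) = 1} }
  refine ⟨_, D.accepts, ⟨Option ι, inferInstance, D, rfl⟩, ?_⟩
  have hnone : ∀ w, D.evalFrom none w = none := by
    intro w
    induction w with
    | nil => rfl
    | cons a w ih => simpa [DFA.evalFrom_cons, D] using ih
  have hfin : ∀ j n, {w | w ∈ D.acceptsFrom (some j) ∧ w.length = n}.Finite := fun j n =>
    (List.finite_length_eq _ n).subset fun w hw => hw.2
  suffices ∀ n j, Set.ncard {w | w ∈ D.acceptsFrom (some j) ∧ w.length = n} = coeff n (G j) from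
    fun n => this n i
  intro n
  induction n with
  | zero =>
    intro j
    have : {w | w ∈ D.acceptsFrom (some j) ∧ w.length = 0} =
        if constantCoeff (G j) = 1 then {[]} else ∅ := by
      ext w
      simp only [Set.mem_ofPred_eq, List.length_eq_zero_iff]
      constructor
      · rintro ⟨h, rfl⟩
        obtain ⟨k, hk, h⟩ := h
        obtain rfl := Option.some.inj hk
        simp [h]
      · split_ifs with h
        · rintro rfl
          exact ⟨⟨j, rfl, h⟩, rfl⟩
        · exact False.elim
    have h1 := h0 j
    rw [this, coeff_zero_eq_constantCoeff_apply]
    split_ifs with h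
    · simp [h]
    · simp; omega
  | succ n ih =>
    intro j
    have : {w | w ∈ D.acceptsFrom (some j) ∧ w.length = n + 1} =
        ⋃ p : Σ k, Fin (M j k),
          (e ⟨(j, p.1), p.2⟩ :: ·) '' {w | w ∈ D.acceptsFrom (some p.1) ∧ w.length = n} := by
      ext w
      simp only [Set.mem_ofPred_eq, Set.mem_iUnion,
        Set.mem_image]
      constructor
      · rintro ⟨h, hl⟩
        rcases w with _ | ⟨a, w⟩
        · simp at hl
        obtain ⟨⟨⟨j', k⟩, c⟩, rfl⟩ := e.surjective a
        rw [DFA.mem_acceptsFrom, DFA.evalFrom_cons] at h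
        by_cases hj : j = j'
        · subst hj
          refine ⟨⟨k, c⟩, w, ⟨?_, by simpa using hl⟩, rfl⟩
          simpa [D, DFA.mem_acceptsFrom] using h
        · simp only [D, Equiv.symm_apply_apply, Option.some.injEq, hj, if_false] at h
          rw [hnone] at h
          obtain ⟨_, h, _⟩ := h
          cases h
      · rintro ⟨p, w, ⟨h, hl⟩, rfl⟩
        refine ⟨?_, by simp [hl]⟩
        rw [DFA.mem_acceptsFrom, DFA.evalFrom_cons]
        simpa [D, DFA.mem_acceptsFrom] using h
    rw [this, Set.ncard_iUnion_of_finite, finsum_eq_sum_of_fintype]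
    · rw [← coeff_shift, hG, map_sum, Fintype.sum_sigma]
      refine Finset.sum_congr rfl fun k _ => ?_
      simp only [Set.ncard_image_of_injective _ List.cons_injective, ih, map_nsmul]
      simp
    · intro p
      exact (hfin _ _).image _
    · intro p q hpq
      refine Set.disjoint_left.2 ?_
      rintro _ ⟨w, _, rfl⟩ ⟨w', _, h⟩
      refine hpq ?_
      obtain ⟨k, c⟩ := p
      obtain ⟨k', c'⟩ := q
      have h1 := e.injective (List.cons.inj h).1
      simp only [A, Sigma.mk.injEq, Prod.mk.injEq, true_and] at h1
      obtain ⟨rfl, h1⟩ := h1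
      rw [eq_of_heq h1]

/-- Generators of the module may have large constant terms, but a state accepts the empty word at
most once. Hence each generator `s` is replaced by `X * s`, whose shift is `s`; the constant term of
`s` becomes the number of transitions to the extra state `1`, and `f` serves as initial state. -/
theorem IsRationalSeries.exists_isRegular {f : PowerSeries ℕ} (hf : IsRationalSeries f)
    (h0 : constantCoeff f ≤ 1) :
    ∃ (m : ℕ) (R : Language (Fin m)), R.IsRegular ∧ ∀ n, countingFunction R n = coeff n f := by
  obtain ⟨S, hS, hS', hf⟩ := hf.isRecognizable
  have := hS.fintype
  have key : ∀ g ∈ Submodule.span ℕ S, ∃ c : S → ℕ, ∑ s, c s • (s : PowerSeries ℕ) = g := by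
    intro g hg
    refine (Submodule.mem_span_range_iff_exists_fun ℕ).1 ?_
    simpa using hg
  choose M hM using fun s : S => key _ (hS' s s.2)
  obtain ⟨c, hc⟩ := key _ (shift_mem_span hS' hf)
  have hdecomp : ∀ s : S, (s : PowerSeries ℕ) =
      constantCoeff (s : PowerSeries ℕ) • 1 + ∑ t, M s t • (X * (t : PowerSeries ℕ)) := by
    intro s
    ext n
    rcases n with _ | n
    · simp
    · have := congrArg (coeff n) (hM s)
      rw [coeff_shift] at this
      rw [← this]
      simp only [map_add, map_sum, map_nsmul, coeff_one, coeff_succ_X_mul]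
      simp
  let G : Option (Option S) → PowerSeries ℕ := fun i => i.elim f fun i => i.elim 1 fun s => X * s.1
  have hX : ∀ g : PowerSeries ℕ, shift (X * g) = g := by
    intro g
    ext n
    simp [coeff_succ_X_mul]
  refine exists_isRegular_of_shift_eq G
    (fun i => i.elim (fun j => j.elim 0 fun j => j.elim
        (∑ s, c s * constantCoeff (s : PowerSeries ℕ)) fun t => ∑ s, c s * M s t)
      fun i => i.elim (fun _ => 0) fun s j => j.elim 0 fun j => j.elim
        (constantCoeff (s : PowerSeries ℕ)) fun t => M s t) ?_ ?_ none
  · rintro (_ | _ | s)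
    · exact h0
    · simp [G]
    · simp [G]
  · rintro (_ | _ | s)
    · simp only [G, Option.elim, Fintype.sum_option, zero_smul, zero_add]
      rw [← hc]
      conv_lhs => enter [2, s]; rw [hdecomp s]
      simp only [smul_add, Finset.sum_add_distrib, Finset.sum_smul, Finset.smul_sum, mul_smul]
      congr 1
      exact Finset.sum_comm
    · simp [G, shift_one]
    · simp only [G, Option.elim, Fintype.sum_option, zero_smul, zero_add]
      rw [hX]
      exact hdecomp s

theorem IsRationalSeries.isCountingRegular {T : Type*} {L : Language T}
    (h : IsRationalSeries (generatingSeries L)) : IsCountingRegular L := by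
  have h0 : constantCoeff (generatingSeries L) ≤ 1 := by
    rw [← coeff_zero_eq_constantCoeff_apply, generatingSeries, coeff_mk]
    refine (Set.ncard_le_ncard (t := {[]}) ?_).trans (Set.ncard_singleton _).le
    rintro w ⟨_, hw⟩
    exact List.length_eq_zero_iff.1 hw
  obtain ⟨m, R, hR, h⟩ := h.exists_isRegular h0
  refine ⟨m, R, hR, ?_⟩
  ext n
  rw [h, generatingSeries, coeff_mk]

/-! ### Rational series -/

namespace IsRationalSeries

open PowerSeries

theorem zero : IsRationalSeries 0 := by
  simpa using IsRationalSeries.polynomial 0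

theorem one : IsRationalSeries 1 := by
  simpa using IsRationalSeries.polynomial 1

theorem X_pow (n : ℕ) : IsRationalSeries (X ^ n) := by
  simpa using IsRationalSeries.polynomial (Polynomial.X ^ n)

theorem sum {ι : Type*} (s : Finset ι) {f : ι → PowerSeries ℕ}
    (h : ∀ i ∈ s, IsRationalSeries (f i)) : IsRationalSeries (∑ i ∈ s, f i) :=
  Finset.sum_induction f IsRationalSeries (fun _ _ => add) zero h

end IsRationalSeries

open PowerSeries in
-- The powers `f ^ k` vanish below degree `k`, so the coefficient of degree `n` of the star is that
-- of the partial sum `S n`.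
theorem PowerSeries.exists_eq_one_add_mul {f : PowerSeries ℕ} (hf : constantCoeff f = 0) :
    ∃ g : PowerSeries ℕ, g = 1 + f * g := by
  have hpow : ∀ n k, n < k → coeff n (f ^ k) = 0 := fun n k h =>
    X_pow_dvd_iff.1 (pow_dvd_pow_of_dvd (X_dvd_iff.2 hf) k) n h
  let S : ℕ → PowerSeries ℕ := fun n => ∑ k ∈ Finset.range (n + 1), f ^ k
  have hS : ∀ d n, coeff n (S (n + d)) = coeff n (S n) := by
    intro d n
    induction d with
    | zero => rfl
    | succ d ih =>
      rw [← ih, ← add_assoc]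
      simp only [S]
      rw [Finset.sum_range_succ _ (n + d + 1), map_add, hpow n _ (by omega), add_zero]
  refine ⟨mk fun n => coeff n (S n), ?_⟩
  ext n
  have h1 : coeff n (f * mk fun n => coeff n (S n)) = coeff n (f * S n) := by
    rw [coeff_mul, coeff_mul]
    refine Finset.sum_congr rfl fun p hp => ?_
    rw [Finset.HasAntidiagonal.mem_antidiagonal] at hp
    rw [coeff_mk, ← hS p.1 p.2, add_comm, hp]
  rw [map_add, h1, ← map_add, coeff_mk, ← hS 1 n]
  congr 1
  simp only [S]
  rw [Finset.sum_range_succ' _ (n + 1), Finset.mul_sum, add_comm, pow_zero]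
  simp only [pow_succ']

open PowerSeries in
-- Arden's lemma: without constant term in `f`, a coefficient of `f * h` involves only earlier
-- coefficients of `h`, so the equation has one solution.
theorem PowerSeries.eq_mul_of_eq_add_mul {f g h r : PowerSeries ℕ} (hf : constantCoeff f = 0)
    (hg : g = 1 + f * g) (hh : h = r + f * h) : h = g * r := by
  have hgr : g * r = r + f * (g * r) := by
    conv_lhs => rw [hg]
    ring
  ext n
  induction n using Nat.strong_induction_on with
  | _ n ih =>
    rw [hh, hgr, map_add, map_add, coeff_mul, coeff_mul]
    congr 1
    refine Finset.sum_congr rfl fun p hp => ?_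
    rw [Finset.HasAntidiagonal.mem_antidiagonal] at hp
    rcases Nat.eq_zero_or_pos p.1 with h0 | h0
    · rw [h0, coeff_zero_eq_constantCoeff_apply, hf, zero_mul, zero_mul]
    · rw [ih p.2 (by omega)]

open PowerSeries in
/-- The components of a solution of a linear system with rational coefficients are rational,
provided that the constant terms of the coefficient matrix have no cycles. -/
theorem IsRationalSeries.of_linear_system {α : Type*} [Preorder α] (ι : Type*) [Finite ι] :
    ∀ [Fintype ι] (F c : ι → PowerSeries ℕ) (P : ι → ι → PowerSeries ℕ) (rank : ι → α),
      (∀ i, IsRationalSeries (c i)) → (∀ i j, IsRationalSeries (P i j)) →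
      (∀ i j, constantCoeff (P i j) ≠ 0 → rank j < rank i) →
      (∀ i, F i = c i + ∑ j, P i j * F j) → ∀ i, IsRationalSeries (F i) := by
  refine Finite.induction_empty_option (P := fun ι => ∀ [Fintype ι] (F c : ι → PowerSeries ℕ)
      (P : ι → ι → PowerSeries ℕ) (rank : ι → α),
      (∀ i, IsRationalSeries (c i)) → (∀ i j, IsRationalSeries (P i j)) →
      (∀ i j, constantCoeff (P i j) ≠ 0 → rank j < rank i) →
      (∀ i, F i = c i + ∑ j, P i j * F j) → ∀ i, IsRationalSeries (F i)) ?_ ?_ ?_ ι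
  · intro κ κ' e ih _ F c P rank hc hP hr hF i
    have := Fintype.ofEquiv _ e.symm
    have := ih (F ∘ e) (c ∘ e) (fun i j => P (e i) (e j)) (rank ∘ e) (fun i => hc _)
      (fun i j => hP _ _) (fun i j => hr _ _)
      (fun i => by
        simp only [Function.comp]
        rw [hF (e i), ← e.sum_comp]) (e.symm i)
    simpa using this
  · intro _ F c P rank _ _ _ _ i
    exact i.elim
  · intro κ _ ih inst F c P rank hc hP hr hF
    obtain rfl : inst = instFintypeOption := Subsingleton.elim _ _
    have h0 : constantCoeff (P none none) = 0 := by
      by_contra h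
      exact lt_irrefl _ (hr _ _ h)
    obtain ⟨g, hg⟩ := exists_eq_one_add_mul h0
    have hgr : IsRationalSeries g := star (hP none none) h0 hg
    have hn : F none = g * (c none + ∑ j, P none (some j) * F (some j)) := by
      refine eq_mul_of_eq_add_mul h0 hg ?_
      conv_lhs => rw [hF none, Fintype.sum_option]
      ring
    have hs : ∀ i, IsRationalSeries (F (some i)) := by
      refine ih (fun i => F (some i)) (fun i => c (some i) + P (some i) none * (g * c none))
        (fun i j => P (some i) (some j) + P (some i) none * (g * P none (some j)))
        (fun i => rank (some i)) ?_ ?_ ?_ ?_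
      · exact fun i => (hc _).add ((hP _ _).mul (hgr.mul (hc _)))
      · exact fun i j => (hP _ _).add ((hP _ _).mul (hgr.mul (hP _ _)))
      -- A constant term of a new coefficient comes from the direct coefficient or from a detour
      -- through the eliminated unknown `none`, along which the rank drops twice.
      · intro i j hij
        by_cases h : constantCoeff (P (some i) (some j)) = 0
        · have h1 : constantCoeff (P (some i) none) ≠ 0 := by
            intro h1; apply hij; simp [h, h1]
          have h2 : constantCoeff (P none (some j)) ≠ 0 := by
            intro h2; apply hij; simp [h, h2]
          exact (hr _ _ h2).trans (hr _ _ h1)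
        · exact hr _ _ h
      · intro i
        conv_lhs => rw [hF (some i), Fintype.sum_option, hn]
        simp only [add_mul, Finset.sum_add_distrib, mul_add, Finset.mul_sum]
        simp only [mul_assoc]
        ring
    rintro (_ | i)
    · rw [hn]
      exact hgr.mul ((hc _).add (sum _ fun j _ => (hP _ _).mul (hs j)))
    · exact hs i

/-! ### Counting paths in finitely branching systems -/

/-- A finitely branching labelled transition system with a weight on its configurations; a step
from `x` to `y` has weight `wt y - wt x`. -/
structure PathSystem (Γ Λ : Type*) where
  /-- the labelled steps from a configuration -/
  out : Γ → Finset (Λ × Γ)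
  /-- the weight of a configuration -/
  wt : Γ → ℕ
  /-- the final configurations -/
  final : Set Γ

namespace PathSystem

open PowerSeries

variable {Γ Λ : Type*}

/-- `S.IsPath x d`: the sequence `d` of labelled steps leads from `x` to a final configuration. -/
def IsPath (S : PathSystem Γ Λ) : Γ → List (Λ × Γ) → Prop
  | x, [] => x ∈ S.final
  | x, e :: d => e ∈ S.out x ∧ S.IsPath e.2 d

/-- The weight of a sequence of steps. -/
def pathWeight (S : PathSystem Γ Λ) : Γ → List (Λ × Γ) → ℕ
  | _, [] => 0
  | x, e :: d => (S.wt e.2 - S.wt x) + S.pathWeight e.2 d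

open Classical in
/-- The generating series, by weight, of the paths of length `s` from `x`. -/
noncomputable def lengthSeries (S : PathSystem Γ Λ) : ℕ → Γ → PowerSeries ℕ
  | 0, x => if x ∈ S.final then 1 else 0
  | s + 1, x => ∑ e ∈ S.out x, X ^ (S.wt e.2 - S.wt x) * S.lengthSeries s e.2

/-- Finiteness is proved along with the count, since counting the disjoint union over the first
steps requires it. -/
theorem finite_paths_and_coeff_lengthSeries (S : PathSystem Γ Λ) (s n : ℕ) (x : Γ) :
    {d | S.IsPath x d ∧ d.length = s ∧ S.pathWeight x d = n}.Finite ∧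
    coeff n (S.lengthSeries s x) =
      {d | S.IsPath x d ∧ d.length = s ∧ S.pathWeight x d = n}.ncard := by
  induction s generalizing n x with
  | zero =>
    have : {d | S.IsPath x d ∧ d.length = 0 ∧ S.pathWeight x d = n} =
        {d | d = [] ∧ x ∈ S.final ∧ n = 0} := by
      ext d
      simp only [Set.mem_ofPred_eq, List.length_eq_zero_iff]
      constructor
      · rintro ⟨h, rfl, h'⟩
        exact ⟨rfl, h, h'.symm⟩
      · rintro ⟨rfl, h, h'⟩
        exact ⟨h, rfl, h'.symm⟩
    rw [this]
    refine ⟨(Set.finite_singleton []).subset fun d hd => hd.1, ?_⟩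
    by_cases hx : x ∈ S.final <;> by_cases hn : n = 0 <;>
      simp [lengthSeries, hx, hn, coeff_one, Set.ncard_singleton]
  | succ s ih =>
    have : {d | S.IsPath x d ∧ d.length = s + 1 ∧ S.pathWeight x d = n} =
        ⋃ e ∈ (S.out x : Set (Λ × Γ)), (e :: ·) '' {d | S.wt e.2 - S.wt x ≤ n ∧
          S.IsPath e.2 d ∧ d.length = s ∧ S.pathWeight e.2 d = n - (S.wt e.2 - S.wt x)} := by
      ext d
      simp only [Set.mem_ofPred_eq, Set.mem_iUnion, Set.mem_image, Finset.mem_coe, exists_prop]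
      constructor
      · rintro ⟨h, hl, hw⟩
        rcases d with _ | ⟨e, d⟩
        · simp at hl
        · rw [pathWeight] at hw
          exact ⟨e, h.1, d, ⟨by omega, h.2, by simpa using hl, by omega⟩, rfl⟩
      · rintro ⟨e, he, d, ⟨hn, h, hl, hw⟩, rfl⟩
        exact ⟨⟨he, h⟩, by simp [hl], by rw [pathWeight]; omega⟩
    have hfin : ∀ e : Λ × Γ, {d | S.wt e.2 - S.wt x ≤ n ∧
        S.IsPath e.2 d ∧ d.length = s ∧ S.pathWeight e.2 d = n - (S.wt e.2 - S.wt x)}.Finite :=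
      fun e => (ih _ e.2).1.subset fun d hd => hd.2
    rw [this]
    refine ⟨(S.out x).finite_toSet.biUnion fun e _ => (hfin e).image _, ?_⟩
    rw [Set.Finite.ncard_biUnion (S.out x).finite_toSet (fun e _ => (hfin e).image _),
      finsum_mem_coe_finset, lengthSeries, map_sum]
    · refine Finset.sum_congr rfl fun e _ => ?_
      rw [Set.ncard_image_of_injective _ List.cons_injective, coeff_X_pow_mul']
      split_ifs with h
      · rw [(ih _ _).2]
        simp [h]
      · simp [h]
    · intro e _ e' _ hne
      refine Set.disjoint_left.2 ?_
      rintro _ ⟨d, _, rfl⟩ ⟨d', _, h⟩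
      exact hne (List.cons.inj h).1.symm

/-! ### Bounded systems and the series of all paths -/

/-- For every weight there is a bound on the length of the paths from `x` of this weight. -/
def IsBounded (S : PathSystem Γ Λ) (x : Γ) : Prop :=
  ∀ n, (Function.support fun s => coeff n (S.lengthSeries s x)).Finite

/-- The generating series of all paths from `x`, by weight. -/
noncomputable def series (S : PathSystem Γ Λ) (x : Γ) : PowerSeries ℕ :=
  PowerSeries.mk fun n => ∑ᶠ s, coeff n (S.lengthSeries s x)

theorem support_eq_image_length (S : PathSystem Γ Λ) (x : Γ) (n : ℕ) :
    (Function.support fun s => coeff n (S.lengthSeries s x)) =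
      List.length '' {d | S.IsPath x d ∧ S.pathWeight x d = n} := by
  ext s
  obtain ⟨hf, hc⟩ := S.finite_paths_and_coeff_lengthSeries s n x
  rw [Function.mem_support, hc, Ne, Set.ncard_eq_zero hf, ← Ne, ← Set.nonempty_iff_ne_empty]
  constructor
  · rintro ⟨d, h1, h2, h3⟩
    exact ⟨d, ⟨h1, h3⟩, h2⟩
  · rintro ⟨d, ⟨h1, h3⟩, h2⟩
    exact ⟨d, h1, h2, h3⟩

theorem isBounded_of_finite {S : PathSystem Γ Λ} {x : Γ}
    (h : ∀ n, {d | S.IsPath x d ∧ S.pathWeight x d = n}.Finite) : S.IsBounded x := by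
  intro n
  rw [support_eq_image_length]
  exact (h n).image _

theorem coeff_series_eq_ncard {S : PathSystem Γ Λ} {x : Γ} (hx : S.IsBounded x) (n : ℕ) :
    coeff n (S.series x) = {d | S.IsPath x d ∧ S.pathWeight x d = n}.ncard := by
  have : {d | S.IsPath x d ∧ S.pathWeight x d = n} =
      ⋃ s ∈ Function.support fun s => coeff n (S.lengthSeries s x),
        {d | S.IsPath x d ∧ d.length = s ∧ S.pathWeight x d = n} := by
    rw [support_eq_image_length]
    ext d
    simp only [Set.mem_iUnion, Set.mem_ofPred_eq, exists_prop]
    constructor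
    · intro h
      exact ⟨d.length, ⟨d, h, rfl⟩, h.1, rfl, h.2⟩
    · rintro ⟨s, _, h1, _, h2⟩
      exact ⟨h1, h2⟩
  rw [this, Set.Finite.ncard_biUnion (hx n)
    (fun s _ => (S.finite_paths_and_coeff_lengthSeries s n x).1)]
  · simp only [← (S.finite_paths_and_coeff_lengthSeries _ n x).2]
    rw [finsum_mem_support, series, coeff_mk]
  · intro s _ s' _ hne
    refine Set.disjoint_left.2 ?_
    rintro d ⟨_, h, _⟩ ⟨_, h', _⟩
    exact hne (h.symm.trans h')

theorem coeff_lengthSeries_succ (S : PathSystem Γ Λ) (n s : ℕ) (x : Γ) :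
    coeff n (S.lengthSeries (s + 1) x) =
      ∑ e ∈ S.out x, coeff n (X ^ (S.wt e.2 - S.wt x) * S.lengthSeries s e.2) := by
  rw [lengthSeries, map_sum]

theorem coeff_lengthSeries_le (S : PathSystem Γ Λ) {x : Γ} {e : Λ × Γ} (he : e ∈ S.out x)
    (n s : ℕ) : coeff n (X ^ (S.wt e.2 - S.wt x) * S.lengthSeries s e.2) ≤
      coeff n (S.lengthSeries (s + 1) x) := by
  rw [coeff_lengthSeries_succ]
  exact Finset.single_le_sum
    (f := fun e : Λ × Γ => coeff n (X ^ (S.wt e.2 - S.wt x) * S.lengthSeries s e.2))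
    (fun _ _ => Nat.zero_le _) he

theorem coeff_lengthSeries_le' (S : PathSystem Γ Λ) {x : Γ} {e : Λ × Γ} (he : e ∈ S.out x)
    (n s : ℕ) : coeff n (S.lengthSeries s e.2) ≤
      coeff (n + (S.wt e.2 - S.wt x)) (S.lengthSeries (s + 1) x) := by
  have := S.coeff_lengthSeries_le he (n + (S.wt e.2 - S.wt x)) s
  rwa [coeff_X_pow_mul] at this

theorem IsBounded.of_mem_out {S : PathSystem Γ Λ} {x : Γ} (hx : S.IsBounded x) {e : Λ × Γ}
    (he : e ∈ S.out x) : S.IsBounded e.2 := by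
  intro n
  refine ((hx (n + (S.wt e.2 - S.wt x))).preimage (Nat.succ_injective.injOn)).subset ?_
  intro s hs
  have := S.coeff_lengthSeries_le' he n s
  simp only [Function.mem_support, Set.mem_preimage, Nat.succ_eq_add_one] at hs ⊢
  omega

theorem coeff_series_of_le {S : PathSystem Γ Λ} {x : Γ} {n N : ℕ}
    (h : ∀ s, N ≤ s → coeff n (S.lengthSeries s x) = 0) :
    coeff n (S.series x) = ∑ s ∈ Finset.range N, coeff n (S.lengthSeries s x) := by
  rw [series, coeff_mk, finsum_eq_sum_of_support_subset]
  intro s hs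
  by_contra hN
  exact hs (h s (by simpa using hN))

open Classical in
theorem series_eq {S : PathSystem Γ Λ} {x : Γ} (hx : S.IsBounded x) :
    S.series x = (if x ∈ S.final then 1 else 0) +
      ∑ e ∈ S.out x, X ^ (S.wt e.2 - S.wt x) * S.series e.2 := by
  ext n
  obtain ⟨N, hN⟩ := (hx n).bddAbove
  have hN' : ∀ s, N + 1 ≤ s → coeff n (S.lengthSeries s x) = 0 := by
    intro s hs
    by_contra h
    have := hN h
    omega
  -- No path of weight `n` is longer than `N`. Splitting off length `0` leaves the lengths `s + 1`,
  -- from which a first step can be removed.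
  rw [coeff_series_of_le (N := N + 2) (fun s hs => hN' s (by omega)), Finset.sum_range_succ',
    add_comm, map_add, map_sum, lengthSeries]
  congr 1
  simp only [coeff_lengthSeries_succ]
  rw [Finset.sum_comm]
  refine Finset.sum_congr rfl fun e he => ?_
  simp only [coeff_X_pow_mul']
  split_ifs with h
  · rw [coeff_series_of_le]
    intro s hs
    have h1 := S.coeff_lengthSeries_le' he (n - (S.wt e.2 - S.wt x)) s
    rw [Nat.sub_add_cancel h, hN' _ (by omega)] at h1
    omega
  · simp

/-- For every weight, the number of configurations on a longest path of this weight. -/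
noncomputable def rank (S : PathSystem Γ Λ) (x : Γ) (n : ℕ) : ℕ :=
  sSup ((· + 1) '' Function.support fun s => coeff n (S.lengthSeries s x))

/-- A step of weight `0` prolongs a longest path of each weight without changing the weight. All
weights are compared at once, in the product order, because no single weight need occur from every
configuration; a nonzero series provides one where the inequality is strict. -/
theorem rank_lt {S : PathSystem Γ Λ} {x : Γ} (hx : S.IsBounded x) {e : Λ × Γ} (he : e ∈ S.out x)
    (hw : S.wt e.2 - S.wt x = 0) (h0 : S.series e.2 ≠ 0) : S.rank e.2 < S.rank x := by
  have key : ∀ n s, coeff n (S.lengthSeries s e.2) ≠ 0 → s + 2 ≤ S.rank x n := by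
    intro n s hs
    refine le_csSup ((hx n).image _).bddAbove ⟨s + 1, ?_, rfl⟩
    have := S.coeff_lengthSeries_le' he n s
    rw [hw, add_zero] at this
    rw [Function.mem_support]
    omega
  have hmem : ∀ n s, coeff n (S.lengthSeries s e.2) ≠ 0 → S.rank e.2 n + 1 ≤ S.rank x n := by
    intro n s hs
    obtain ⟨s', hs', h⟩ := Nat.sSup_mem (s := (· + 1) '' Function.support fun s =>
      coeff n (S.lengthSeries s e.2)) ⟨_, s, hs, rfl⟩
      (((hx.of_mem_out he) n).image _).bddAbove
    have := key n s' hs'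
    dsimp only at h
    rw [rank, ← h]
    exact this
  rw [Pi.lt_def]
  constructor
  · intro n
    by_cases h : ∃ s, coeff n (S.lengthSeries s e.2) ≠ 0
    · obtain ⟨s, hs⟩ := h
      exact (Nat.le_succ _).trans (hmem n s hs)
    · push Not at h
      have : (Function.support fun s => coeff n (S.lengthSeries s e.2)) = ∅ := by
        ext s
        simp [h]
      rw [rank, this]
      simp
  · obtain ⟨n, hn⟩ : ∃ n, coeff n (S.series e.2) ≠ 0 := by
      by_contra! h
      exact h0 (PowerSeries.ext fun n => by simpa using h n)
    obtain ⟨s, hs⟩ : ∃ s, coeff n (S.lengthSeries s e.2) ≠ 0 := by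
      by_contra! h
      rw [series, coeff_mk] at hn
      simp [h] at hn
    exact ⟨n, hmem n s hs⟩

/-! ### Bisimulations of finite index -/

/-- Related configurations have corresponding steps of the same weights to related
configurations. -/
def IsBisimulation (S : PathSystem Γ Λ) (r : Γ → Γ → Prop) : Prop :=
  ∀ x x', r x x' → (x ∈ S.final ↔ x' ∈ S.final) ∧
    ∃ f : Λ × Γ → Λ × Γ, Set.BijOn f (S.out x) (S.out x') ∧
      ∀ e ∈ S.out x, S.wt (f e).2 - S.wt x' = S.wt e.2 - S.wt x ∧ r e.2 (f e).2

theorem IsBisimulation.lengthSeries_eq {S : PathSystem Γ Λ} {r : Γ → Γ → Prop}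
    (hr : S.IsBisimulation r) (s : ℕ) :
    ∀ {x x' : Γ}, r x x' → S.lengthSeries s x = S.lengthSeries s x' := by
  induction s with
  | zero =>
    intro x x' h
    have := (hr x x' h).1
    by_cases hx : x ∈ S.final
    · simp [lengthSeries, hx, this.1 hx]
    · simp [lengthSeries, hx, mt this.2 hx]
  | succ s ih =>
    intro x x' h
    obtain ⟨_, f, hf, hf'⟩ := hr x x' h
    rw [lengthSeries, lengthSeries]
    refine Finset.sum_nbij f hf.mapsTo hf.injOn hf.surjOn fun e he => ?_
    rw [(hf' e he).1, ih (hf' e he).2]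

theorem IsBisimulation.series_eq {S : PathSystem Γ Λ} {r : Γ → Γ → Prop}
    (hr : S.IsBisimulation r) {x x' : Γ} (h : r x x') : S.series x = S.series x' := by
  simp only [series, hr.lengthSeries_eq _ h]

theorem IsBisimulation.rank_eq {S : PathSystem Γ Λ} {r : Γ → Γ → Prop}
    (hr : S.IsBisimulation r) {x x' : Γ} (h : r x x') : S.rank x = S.rank x' := by
  ext n
  simp only [rank, hr.lengthSeries_eq _ h]

open Classical in
-- The unknowns are the classes of bounded configurations with nonzero series. Configurations that
-- reach no final one must be left out: steps of weight `0` may form cycles among them, and they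
-- contribute nothing.
theorem IsBisimulation.isRationalSeries {S : PathSystem Γ Λ} {r : Γ → Γ → Prop}
    (hr : S.IsBisimulation r) {Q : Type*} [Finite Q] (σ : Γ → Q)
    (hσ : ∀ x x', σ x = σ x' → r x x') {x₀ : Γ} (hx₀ : S.IsBounded x₀) :
    IsRationalSeries (S.series x₀) := by
  let ι := {q : Q // ∃ x, σ x = q ∧ S.IsBounded x ∧ S.series x ≠ 0}
  have := Fintype.ofFinite ι
  by_cases h0 : S.series x₀ = 0
  · rw [h0]
    exact IsRationalSeries.zero
  choose rep hrep hbdd hne using fun i : ι => i.2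
  let P : ι → ι → PowerSeries ℕ := fun i j => ∑ e ∈ S.out (rep i),
    if S.series e.2 ≠ 0 ∧ σ e.2 = j then X ^ (S.wt e.2 - S.wt (rep i)) else 0
  have key := IsRationalSeries.of_linear_system ι (fun i => S.series (rep i))
    (fun i => if rep i ∈ S.final then 1 else 0) P (fun i => S.rank (rep i)) ?_ ?_ ?_ ?_
    ⟨σ x₀, x₀, rfl, hx₀, h0⟩
  · rwa [hr.series_eq (hσ _ _ (hrep _))] at key
  · intro i
    split_ifs
    exacts [IsRationalSeries.one, IsRationalSeries.zero]
  · intro i j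
    refine IsRationalSeries.sum _ fun e _ => ?_
    split_ifs
    exacts [IsRationalSeries.X_pow _, IsRationalSeries.zero]
  · intro i j hij
    simp only [P, map_sum] at hij
    obtain ⟨e, he, h⟩ := Finset.exists_ne_zero_of_sum_ne_zero hij
    split_ifs at h with hc
    · have hw : S.wt e.2 - S.wt (rep i) = 0 := by
        by_contra hw
        simp [hw] at h
      rw [← hr.rank_eq (hσ e.2 (rep j) (hc.2.trans (hrep j).symm))]
      exact rank_lt (hbdd i) he hw hc.1
    · simp at h
  · intro i
    rw [PathSystem.series_eq (hbdd i)]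
    congr 1
    simp only [P, Finset.sum_mul]
    rw [Finset.sum_comm]
    refine Finset.sum_congr rfl fun e he => ?_
    by_cases h : S.series e.2 = 0
    · simp [h]
    · have hj : ∃ j : ι, (j : Q) = σ e.2 := ⟨⟨σ e.2, e.2, rfl, (hbdd i).of_mem_out he, h⟩, rfl⟩
      obtain ⟨j, hj⟩ := hj
      rw [Fintype.sum_eq_single j]
      · rw [if_pos ⟨h, hj.symm⟩, hr.series_eq (hσ _ _ ((hrep j).trans hj))]
      · intro j' hj'
        rw [if_neg, zero_mul]
        rintro ⟨_, h'⟩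
        exact hj' (Subtype.ext (h'.symm.trans hj.symm))

/-- If the words of a language correspond to the paths of a system with a bisimulation of finite
index, then its generating series is rational. -/
theorem IsBisimulation.isRationalSeries_generatingSeries {S : PathSystem Γ Λ}
    {r : Γ → Γ → Prop} (hr : S.IsBisimulation r) {Q : Type*} [Finite Q] (σ : Γ → Q)
    (hσ : ∀ x x', σ x = σ x' → r x x') (x₀ : Γ) {T : Type*} [Finite T] (L : Language T)
    (f : List (Λ × Γ) → List T) (hf : Set.BijOn f {d | S.IsPath x₀ d} L)
    (hlen : ∀ d, S.IsPath x₀ d → (f d).length = S.pathWeight x₀ d) :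
    IsRationalSeries (generatingSeries L) := by
  have hbij : ∀ n, Set.BijOn f {d | S.IsPath x₀ d ∧ S.pathWeight x₀ d = n}
      {w | w ∈ L ∧ w.length = n} := by
    intro n
    refine ⟨?_, hf.injOn.mono fun d hd => hd.1, ?_⟩
    · rintro d ⟨h, hw⟩
      exact ⟨hf.mapsTo h, (hlen d h).trans hw⟩
    · rintro w ⟨hw, hl⟩
      obtain ⟨d, hd, rfl⟩ := hf.surjOn hw
      exact ⟨d, ⟨hd, (hlen d hd).symm.trans hl⟩, rfl⟩
  -- Boundedness is inherited from the language: there are only finitely many words of each length.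
  have hb : S.IsBounded x₀ := isBounded_of_finite fun n => by
    refine Set.Finite.of_finite_image ?_ (hbij n).injOn
    rw [(hbij n).image_eq]
    exact (List.finite_length_eq T n).subset fun w hw => hw.2
  have : generatingSeries L = S.series x₀ := by
    ext n
    rw [coeff_series_eq_ncard hb, generatingSeries, coeff_mk, countingFunction,
      ← (hbij n).image_eq, (hbij n).injOn.ncard_image]
  rw [this]
  exact hr.isRationalSeries σ hσ hb

end PathSystem

/-! ### Replacing the nonterminals of a sentential form -/

namespace SententialForm

variable {T N : Type*}

/-- The sequence of nonterminals of a sentential form. -/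
def nonterminals : List (Symbol T N) → List N
  | [] => []
  | Symbol.terminal _ :: x => nonterminals x
  | Symbol.nonterminal A :: x => A :: nonterminals x

/-- The sequence of terminals of a sentential form. -/
def terminals : List (Symbol T N) → List T
  | [] => []
  | Symbol.terminal a :: x => a :: terminals x
  | Symbol.nonterminal _ :: x => terminals x

/-- The sentential form that arises when the nonterminals of a form are replaced, from left to
right, by given words. -/
def fill : List (Symbol T N) → List (List (Symbol T N)) → List (Symbol T N)
  | [], _ => []
  | Symbol.terminal a :: x, α => Symbol.terminal a :: fill x α
  | Symbol.nonterminal _ :: _, [] => []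
  | Symbol.nonterminal _ :: x, β :: α => β ++ fill x α

theorem length_nonterminals (x : List (Symbol T N)) :
    (nonterminals x).length = numNonterminals x := by
  induction x with
  | nil => rfl
  | cons s x ih => cases s <;> simp [nonterminals, numNonterminals, ih]

theorem nonterminals_append (x y : List (Symbol T N)) :
    nonterminals (x ++ y) = nonterminals x ++ nonterminals y := by
  induction x with
  | nil => rfl
  | cons s x ih => cases s <;> simp [nonterminals, ih]

theorem terminals_append (x y : List (Symbol T N)) :
    terminals (x ++ y) = terminals x ++ terminals y := by
  induction x with
  | nil => rfl
  | cons s x ih => cases s <;> simp [terminals, ih]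

theorem length_terminals_add (x : List (Symbol T N)) :
    (terminals x).length + (nonterminals x).length = x.length := by
  induction x with
  | nil => rfl
  | cons s x ih => cases s <;> simp [terminals, nonterminals] <;> omega

@[simp]
theorem nonterminals_map_terminal (w : List T) :
    nonterminals (w.map Symbol.terminal : List (Symbol T N)) = [] := by
  induction w with
  | nil => rfl
  | cons a w ih => simpa [nonterminals] using ih

@[simp]
theorem terminals_map_terminal (w : List T) :
    terminals (w.map Symbol.terminal : List (Symbol T N)) = w := by
  induction w with
  | nil => rfl
  | cons a w ih => simpa [terminals] using ih

theorem map_terminals_of_nonterminals_eq_nil {x : List (Symbol T N)} (h : nonterminals x = []) :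
    (terminals x).map Symbol.terminal = x := by
  induction x with
  | nil => rfl
  | cons s x ih => cases s <;> simp_all [terminals, nonterminals]

@[simp]
theorem fill_map_terminal_append (w : List T) (x : List (Symbol T N))
    (α : List (List (Symbol T N))) :
    fill (w.map Symbol.terminal ++ x) α = w.map Symbol.terminal ++ fill x α := by
  induction w with
  | nil => rfl
  | cons a w ih => simpa [fill] using ih

@[simp]
theorem fill_map_terminal (w : List T) (α : List (List (Symbol T N))) :
    fill (w.map Symbol.terminal) α = w.map Symbol.terminal := by
  simpa [fill] using fill_map_terminal_append w [] α

theorem fill_append {x : List (Symbol T N)} {α : List (List (Symbol T N))}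
    (h : α.length = (nonterminals x).length) (y : List (Symbol T N))
    (β : List (List (Symbol T N))) : fill (x ++ y) (α ++ β) = fill x α ++ fill y β := by
  induction x generalizing α with
  | nil =>
    obtain rfl : α = [] := by simpa [nonterminals] using h
    rfl
  | cons s x ih =>
    cases s with
    | terminal a => simpa [fill] using ih h
    | nonterminal A =>
      rcases α with _ | ⟨γ, α⟩
      · simp [nonterminals] at h
      · simpa [fill] using ih (by simpa [nonterminals] using h)

theorem fill_singletons (x : List (Symbol T N)) :
    fill x ((nonterminals x).map fun A => [Symbol.nonterminal A]) = x := by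
  induction x with
  | nil => rfl
  | cons s x ih => cases s <;> simpa [fill, nonterminals] using ih

theorem nonterminals_fill {x : List (Symbol T N)} {α : List (List (Symbol T N))}
    (h : α.length = (nonterminals x).length) :
    nonterminals (fill x α) = α.flatMap nonterminals := by
  induction x generalizing α with
  | nil =>
    obtain rfl : α = [] := by simpa [nonterminals] using h
    rfl
  | cons s x ih =>
    cases s with
    | terminal a => simpa [fill, nonterminals] using ih h
    | nonterminal A =>
      rcases α with _ | ⟨γ, α⟩
      · simp [nonterminals] at h
      · simp [fill, nonterminals_append, ih (by simpa [nonterminals] using h)]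

theorem length_terminals_fill {x : List (Symbol T N)} {α : List (List (Symbol T N))}
    (h : α.length = (nonterminals x).length) :
    (terminals (fill x α)).length = (terminals x).length + (α.flatMap terminals).length := by
  induction x generalizing α with
  | nil =>
    obtain rfl : α = [] := by simpa [nonterminals] using h
    rfl
  | cons s x ih =>
    cases s with
    | terminal a =>
      have := ih h
      simp only [fill, terminals, List.length_cons]
      omega
    | nonterminal A =>
      rcases α with _ | ⟨γ, α⟩
      · simp [nonterminals] at h
      · have := ih (α := α) (by simpa [nonterminals] using h)
        simp only [fill, terminals_append, terminals, List.length_append, List.flatMap_cons]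
        omega

theorem nonterminals_eq_append {x : List (Symbol T N)} {s t : List N}
    (h : nonterminals x = s ++ t) :
    ∃ y z, x = y ++ z ∧ nonterminals y = s ∧ nonterminals z = t := by
  induction x generalizing s with
  | nil =>
    obtain ⟨rfl, rfl⟩ := List.append_eq_nil_iff.1 h.symm
    exact ⟨[], [], rfl, rfl, rfl⟩
  | cons a x ih =>
    cases a with
    | terminal a =>
      obtain ⟨y, z, rfl, rfl, rfl⟩ := ih h
      exact ⟨Symbol.terminal a :: y, z, rfl, rfl, rfl⟩
    | nonterminal A =>
      rcases s with _ | ⟨B, s⟩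
      · exact ⟨[], _, rfl, rfl, h⟩
      · obtain ⟨rfl, h1⟩ := List.cons.inj h
        obtain ⟨y, z, rfl, rfl, rfl⟩ := ih h1
        exact ⟨Symbol.nonterminal A :: y, z, rfl, rfl, rfl⟩

theorem nonterminals_eq_cons {x : List (Symbol T N)} {A : N} {t : List N}
    (h : nonterminals x = A :: t) :
    ∃ (w : List T) (z : List (Symbol T N)),
      x = w.map Symbol.terminal ++ Symbol.nonterminal A :: z ∧ nonterminals z = t := by
  induction x with
  | nil => cases h
  | cons a x ih =>
    cases a with
    | terminal a =>
      obtain ⟨w, z, rfl, rfl⟩ := ih h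
      exact ⟨a :: w, z, rfl, rfl⟩
    | nonterminal B =>
      obtain ⟨rfl, rfl⟩ := List.cons.inj h
      exact ⟨[], x, rfl, rfl⟩

/-! ### Equivalence of sentential forms -/

/-- Two words are equivalent if they satisfy the same equations `a u = u b` with words `a`, `b` of
length at most `K`. -/
def WordEquiv {α : Type*} (K : ℕ) (u u' : List α) : Prop :=
  ∀ a b : List α, a.length ≤ K → b.length ≤ K → (a ++ u = u ++ b ↔ a ++ u' = u' ++ b)

/-- Both sides are cut after `a.length + u.length` letters. The overhang `c` is as long as `a`, so
length bounds survive the passage across `u`. -/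
theorem append_append_eq_append_append_iff {α : Type*} {a u v z : List α} :
    a ++ (u ++ v) = u ++ z ↔
      ∃ c : List α, c.length = a.length ∧ a ++ u = u ++ c ∧ c ++ v = z := by
  constructor
  · intro h
    rw [← List.append_assoc] at h
    rcases List.append_eq_append_iff.1 h with ⟨c, h1, h2⟩ | ⟨c, h1, h2⟩
    · have := congrArg List.length h1
      simp only [List.length_append] at this
      obtain rfl : c = [] := List.length_eq_zero_iff.1 (by omega)
      obtain rfl : a = [] := List.length_eq_zero_iff.1 (by simpa using this)
      exact ⟨[], rfl, by simp, by simpa using h2⟩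
    · refine ⟨c, ?_, h1, h2.symm⟩
      have := congrArg List.length h1
      simp only [List.length_append] at this
      omega
  · rintro ⟨c, _, h1, rfl⟩
    rw [← List.append_assoc, h1, List.append_assoc]

namespace WordEquiv

variable {α : Type*} {K : ℕ} {u u' v v' : List α}

theorem refl (u : List α) : WordEquiv K u u := fun _ _ _ _ => Iff.rfl

theorem symm (h : WordEquiv K u u') : WordEquiv K u' u := fun a b ha hb => (h a b ha hb).symm

/-- The relation `a w = w b` for `w = u v` is the composite of those for `u` and `v`, through a
middle word as long as `a`. -/
theorem append (hu : WordEquiv K u u') (hv : WordEquiv K v v') :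
    WordEquiv K (u ++ v) (u' ++ v') := by
  intro a b ha hb
  simp only [List.append_assoc, append_append_eq_append_append_iff]
  refine exists_congr fun c => and_congr_right fun hc => ?_
  rw [hu a c ha (hc.trans_le ha), hv c b (hc.trans_le ha) hb]

end WordEquiv

/-- Two sentential forms are equivalent if they have the same nonterminals and equivalent
terminal words between them. -/
inductive FormEquiv (K : ℕ) : List (Symbol T N) → List (Symbol T N) → Prop
  | terminal {u u' : List T} :
      WordEquiv K (u.map Symbol.terminal : List (Symbol T N)) (u'.map Symbol.terminal) →
        FormEquiv K (u.map Symbol.terminal) (u'.map Symbol.terminal)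
  | nonterminal {u u' : List T} {x x' : List (Symbol T N)} (A : N) :
      WordEquiv K (u.map Symbol.terminal : List (Symbol T N)) (u'.map Symbol.terminal) →
        FormEquiv K x x' →
          FormEquiv K (u.map Symbol.terminal ++ Symbol.nonterminal A :: x)
            (u'.map Symbol.terminal ++ Symbol.nonterminal A :: x')

namespace FormEquiv

variable {K : ℕ} {x x' y y' : List (Symbol T N)}

theorem symm (h : FormEquiv K x x') : FormEquiv K x' x := by
  induction h with
  | terminal h => exact .terminal h.symm
  | nonterminal A h _ ih => exact .nonterminal A h.symm ih

/-- The last terminal word of `x` fuses with the first one of `y`; this is where `WordEquiv` has to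
be a congruence. -/
theorem append (hx : FormEquiv K x x') (hy : FormEquiv K y y') :
    FormEquiv K (x ++ y) (x' ++ y') := by
  induction hx with
  | terminal h =>
    cases hy with
    | terminal h' =>
      have := h.append h'
      rw [← List.map_append, ← List.map_append] at this ⊢
      exact .terminal this
    | nonterminal A h' hy =>
      have := h.append h'
      rw [← List.append_assoc, ← List.append_assoc]
      rw [← List.map_append, ← List.map_append] at this ⊢
      exact .nonterminal A this hy
  | nonterminal A h _ ih =>
    rw [List.append_assoc, List.append_assoc]
    exact .nonterminal A h ih

theorem refl (x : List (Symbol T N)) : FormEquiv K x x := by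
  induction x with
  | nil => exact .terminal (u := []) (u' := []) (.refl _)
  | cons s x ih =>
    cases s with
    | terminal a => exact append (.terminal (u := [a]) (u' := [a]) (.refl _)) ih
    | nonterminal A => exact .nonterminal (u := []) (u' := []) A (.refl _) ih

theorem nonterminals_eq (h : FormEquiv K x x') : nonterminals x = nonterminals x' := by
  induction h with
  | terminal _ => simp
  | nonterminal A _ _ ih => simp [nonterminals_append, nonterminals, ih]

theorem fill (h : FormEquiv K x x') {α : List (List (Symbol T N))}
    (hα : α.length = (nonterminals x).length) :
    FormEquiv K (SententialForm.fill x α) (SententialForm.fill x' α) := by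
  induction h generalizing α with
  | terminal h => simpa using FormEquiv.terminal h
  | nonterminal A h _ ih =>
    rcases α with _ | ⟨β, α⟩
    · simp [nonterminals_append, nonterminals] at hα
    · simp only [fill_map_terminal_append, SententialForm.fill]
      exact append (.terminal h)
        (append (.refl _) (ih (by simpa [nonterminals_append, nonterminals] using hα)))

/-- Both fillings are read from left to right, with `δ` the amount by which one is ahead. Crossing a
terminal word `u` turns `δ` into some `ε` with `δ u = u ε`, a condition that equivalent words share.
Crossing a nonterminal changes the overhang by the inserted words, which the bound on the total
length pays for. -/
theorem append_fill_eq (h : FormEquiv K x x') {δ : List (Symbol T N)}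
    {α β : List (List (Symbol T N))} (hα : α.length = (nonterminals x).length)
    (hβ : β.length = (nonterminals x).length)
    (hK : δ.length + α.flatten.length + β.flatten.length ≤ K)
    (heq : δ ++ SententialForm.fill x α = SententialForm.fill x β) :
    δ ++ SententialForm.fill x' α = SententialForm.fill x' β := by
  induction h generalizing δ α β with
  | terminal h =>
    simp only [fill_map_terminal] at heq ⊢
    have := (h δ [] (by omega) (by simp)).1
    simp only [List.append_nil] at this
    exact this heq
  | nonterminal A h _ ih =>
    rcases α with _ | ⟨γ, α⟩
    · simp [nonterminals_append, nonterminals] at hα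
    rcases β with _ | ⟨γ', β⟩
    · simp [nonterminals_append, nonterminals] at hβ
    simp only [fill_map_terminal_append, SententialForm.fill] at heq ⊢
    simp only [nonterminals_append, nonterminals, nonterminals_map_terminal, List.nil_append,
      List.length_cons, Nat.add_right_cancel_iff] at hα hβ
    simp only [List.flatten_cons, List.length_append] at hK
    rw [append_append_eq_append_append_iff] at heq ⊢
    obtain ⟨ε, hε, h1, h2⟩ := heq
    refine ⟨ε, hε, (h δ ε (by omega) (by omega)).1 h1, ?_⟩
    rw [← List.append_assoc] at h2 ⊢
    -- If the word inserted on the right overtakes, the two fillings exchange roles.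
    rcases List.append_eq_append_iff.1 h2 with ⟨η, rfl, h3⟩ | ⟨η, h3, h4⟩
    · have := ih hβ hα (δ := η) (by simp only [List.length_append] at hK; omega) h3.symm
      rw [← this]
      simp
    · have hl := congrArg List.length h3
      simp only [List.length_append] at hl
      rw [h3, List.append_assoc, ih hα hβ (by omega) h4.symm]

theorem fill_eq (h : FormEquiv K x x') {α β : List (List (Symbol T N))}
    (hα : α.length = (nonterminals x).length) (hβ : β.length = (nonterminals x).length)
    (hK : α.flatten.length + β.flatten.length ≤ K)
    (heq : SententialForm.fill x α = SententialForm.fill x β) :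
    SententialForm.fill x' α = SententialForm.fill x' β :=
  append_fill_eq h (δ := []) hα hβ (by simpa using hK) heq

end FormEquiv

/-! ### Finite index of the equivalence -/

/-- The solutions `(a, b)` of length at most `K` of the equation `a u = u b`. -/
def conjugators {α : Type*} (K : ℕ) (u : List α) :
    Set ({a : List α // a.length ≤ K} × {a : List α // a.length ≤ K}) :=
  {p | p.1.1 ++ u = u ++ p.2.1}

theorem wordEquiv_of_conjugators_eq {α : Type*} {K : ℕ} {u u' : List α}
    (h : conjugators K u = conjugators K u') : WordEquiv K u u' := fun a b ha hb =>
  Set.ext_iff.1 h (⟨a, ha⟩, ⟨b, hb⟩)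

/-- The invariants of the terminal words between the nonterminals of the form `u x`, each with the
following nonterminal. -/
def code (K : ℕ) : List T → List (Symbol T N) →
    List (Set ({a : List (Symbol T N) // a.length ≤ K} ×
      {a : List (Symbol T N) // a.length ≤ K}) × Option N)
  | u, [] => [(conjugators K (u.map Symbol.terminal), none)]
  | u, Symbol.terminal a :: x => code K (u ++ [a]) x
  | u, Symbol.nonterminal A :: x => (conjugators K (u.map Symbol.terminal), some A) :: code K [] x

theorem length_code (K : ℕ) (u : List T) (x : List (Symbol T N)) :
    (code K u x).length = numNonterminals x + 1 := by
  induction x generalizing u with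
  | nil => rfl
  | cons s x ih => cases s <;> simp [code, numNonterminals, ih]

theorem code_eq_cons_none {K : ℕ} {u : List T} {x : List (Symbol T N)} {r l}
    (h : code K u x = (r, none) :: l) : ∃ v : List T,
      u.map Symbol.terminal ++ x = v.map Symbol.terminal ∧
        conjugators K (v.map Symbol.terminal) = r := by
  induction x generalizing u with
  | nil =>
    simp only [code, List.cons.injEq, Prod.mk.injEq] at h
    exact ⟨u, by simp, h.1.1⟩
  | cons s x ih =>
    cases s with
    | terminal a =>
      obtain ⟨v, h1, h2⟩ := ih h
      exact ⟨v, by simpa using h1, h2⟩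
    | nonterminal A => simp [code] at h

theorem code_eq_cons_some {K : ℕ} {u : List T} {x : List (Symbol T N)} {r A l}
    (h : code K u x = (r, some A) :: l) : ∃ (v : List T) (y : List (Symbol T N)),
      u.map Symbol.terminal ++ x = v.map Symbol.terminal ++ Symbol.nonterminal A :: y ∧
        conjugators K (v.map Symbol.terminal) = r ∧ code K [] y = l := by
  induction x generalizing u with
  | nil => simp [code] at h
  | cons s x ih =>
    cases s with
    | terminal a =>
      obtain ⟨v, y, h1, h2⟩ := ih h
      exact ⟨v, y, by simpa using h1, h2⟩
    | nonterminal B =>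
      simp only [code, List.cons.injEq, Prod.mk.injEq, Option.some.injEq] at h
      obtain ⟨⟨h1, rfl⟩, h2⟩ := h
      exact ⟨u, x, rfl, h1, h2⟩

theorem formEquiv_of_code_eq {K : ℕ} {u u' : List T} {x x' : List (Symbol T N)}
    (h : code K u x = code K u' x') :
    FormEquiv K (u.map Symbol.terminal ++ x) (u'.map Symbol.terminal ++ x') := by
  induction x generalizing u u' x' with
  | nil =>
    obtain ⟨v, h1, h2⟩ := code_eq_cons_none h.symm
    rw [h1, List.append_nil]
    exact .terminal (wordEquiv_of_conjugators_eq h2.symm)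
  | cons s x ih =>
    cases s with
    | terminal a => simpa using ih (u := u ++ [a]) h
    | nonterminal A =>
      obtain ⟨v, y, h1, h2, h3⟩ := code_eq_cons_some h.symm
      rw [h1]
      exact .nonterminal A (wordEquiv_of_conjugators_eq h2.symm) (ih (u := []) (u' := []) h3.symm)

/-- The sentential forms with at most `k` nonterminals. -/
abbrev Bounded (T N : Type*) (k : ℕ) := {x : List (Symbol T N) // numNonterminals x ≤ k}

/-- There are finitely many words of length at most `K`, hence finitely many sets of conjugators,
and a code has one entry more than the form has nonterminals. -/
theorem exists_finite_index_formEquiv (T : Type*) (N : Type*) [Finite T] [Finite N] (K k : ℕ) :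
    ∃ (l : Set (List (Set ({a : List (Symbol T N) // a.length ≤ K} ×
      {a : List (Symbol T N) // a.length ≤ K}) × Option N))) (σ : Bounded T N k → l),
      l.Finite ∧ ∀ x x', σ x = σ x' → FormEquiv K x.1 x'.1 := by
  have := Fintype.ofFinite T
  have := Fintype.ofFinite N
  have : Finite {a : List (Symbol T N) // a.length ≤ K} := List.finite_length_le _ K
  refine ⟨{l | l.length ≤ k + 1}, fun x => ⟨code K [] x.1, ?_⟩, List.finite_length_le _ _, ?_⟩
  · simpa [length_code] using x.2
  · intro x x' h
    exact formEquiv_of_code_eq (u := []) (u' := []) (Subtype.ext_iff.1 h)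

/-! ### Bisimulations between sentential forms -/

/-- A relation on sentential forms is a bisimulation if every step from `x` replaces the
nonterminals of `x` by words, and for related forms the same replacements are possible and lead to
related forms. -/
theorem isBisimulation_of_fill {Λ : Type*} {k : ℕ} (S : PathSystem (Bounded T N k) Λ)
    (hwt : ∀ x, S.wt x = (terminals x.1).length)
    (hfinal : ∀ x, x ∈ S.final ↔ nonterminals x.1 = [])
    (r : List (Symbol T N) → List (Symbol T N) → Prop) (hsymm : ∀ x x', r x x' → r x' x)
    (hnt : ∀ x x', r x x' → nonterminals x = nonterminals x')
    (hfill : ∀ x x' α, r x x' → α.length = (nonterminals x).length → r (fill x α) (fill x' α))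
    (good : Λ → List (List (Symbol T N)) → Prop)
    (heq : ∀ x x' l α β, r x x' → α.length = (nonterminals x).length →
      β.length = (nonterminals x).length → good l α → good l β → fill x α = fill x β →
        fill x' α = fill x' β)
    (hout : ∀ x, ∀ e ∈ S.out x, ∃ α, α.length = (nonterminals x.1).length ∧ good e.1 α ∧
      e.2.1 = fill x.1 α ∧ ∀ x' : Bounded T N k, r x.1 x'.1 →
        ∃ y : Bounded T N k, y.1 = fill x'.1 α ∧ (e.1, y) ∈ S.out x') :
    S.IsBisimulation fun x x' => r x.1 x'.1 := by
  intro x x' h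
  have hn := hnt _ _ h
  refine ⟨by rw [hfinal, hfinal, hn], ?_⟩
  choose! α hlen hgood hα hα' using hout x
  have : Nonempty (Bounded T N k) := ⟨x⟩
  choose! g hg hg' using fun e he => hα' e he x' h
  -- The same words are filled into `x'`. Injectivity holds because fillings that coincide at `x'`
  -- coincide at `x`, surjectivity because of the converse.
  refine ⟨fun e => (e.1, g e), ⟨fun e he => hg' e he, ?_, ?_⟩, ?_⟩
  · intro e he e' he' hee
    obtain ⟨h1, h2⟩ := Prod.mk.inj hee
    refine Prod.ext h1 (Subtype.ext ?_)
    rw [hα e he, hα e' he']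
    refine heq x'.1 x.1 e.1 _ _ (hsymm _ _ h) (by rw [hlen e he, hn]) (by rw [hlen e' he', hn])
      (hgood e he) (h1 ▸ hgood e' he') ?_
    rw [← hg e he, ← hg e' he', h2]
  · intro e' he'
    obtain ⟨β, hβ, hgβ, hβ1, hβ2⟩ := hout x' e' he'
    obtain ⟨y, hy, hy'⟩ := hβ2 x (hsymm _ _ h)
    refine ⟨(e'.1, y), hy', Prod.ext rfl (Subtype.ext ?_)⟩
    rw [hβ1, hg _ hy']
    refine heq x.1 x'.1 e'.1 _ _ h (hlen _ hy') (by rw [hβ, hn]) (hgood _ hy') hgβ ?_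
    rw [← hα _ hy', hy]
  · intro e he
    refine ⟨?_, ?_⟩
    · rw [hwt, hwt, hwt, hwt, hg e he, hα e he, length_terminals_fill (hlen e he),
        length_terminals_fill (by rw [hlen e he, hn])]
      omega
    · dsimp only
      rw [hg e he, hα e he]
      exact hfill _ _ _ h (hlen e he)

end SententialForm

/-! ### Endpoints and weights of paths -/

namespace PathSystem

variable {Γ Λ : Type*}

/-- The last configuration of a sequence of steps from `x`. -/
def endpoint : Γ → List (Λ × Γ) → Γ
  | x, [] => x
  | _, e :: d => endpoint e.2 d

theorem IsPath.endpoint_mem_final {S : PathSystem Γ Λ} {x : Γ} {d : List (Λ × Γ)}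
    (h : S.IsPath x d) : endpoint x d ∈ S.final := by
  induction d generalizing x with
  | nil => exact h
  | cons e d ih => exact ih h.2

/-- The weights telescope; monotonicity guards against the truncated subtraction. -/
theorem IsPath.wt_add_pathWeight {S : PathSystem Γ Λ}
    (hmono : ∀ x, ∀ e ∈ S.out x, S.wt x ≤ S.wt e.2) {x : Γ} {d : List (Λ × Γ)}
    (h : S.IsPath x d) : S.wt x + S.pathWeight x d = S.wt (endpoint x d) := by
  induction d generalizing x with
  | nil => rfl
  | cons e d ih =>
    have h1 := ih h.2
    have h2 := hmono x e h.1
    rw [pathWeight, endpoint]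
    omega

end PathSystem

theorem numNonterminals_le_of_indexOfForms_le {T N : Type*} {xs : List (List (Symbol T N))}
    {k : ℕ} (h : indexOfForms xs ≤ k) : ∀ x ∈ xs, numNonterminals x ≤ k := by
  induction xs with
  | nil => simp
  | cons y xs ih =>
    simp only [indexOfForms, List.map_cons, List.foldr_cons, max_le_iff] at h
    intro x hx
    rcases List.mem_cons.1 hx with rfl | hx
    · exact h.1
    · exact ih h.2 x hx

theorem SententialForm.length_fill {T N : Type*} {x : List (Symbol T N)}
    {α : List (List (Symbol T N))} (h : α.length = (nonterminals x).length) :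
    (fill x α).length = (terminals x).length + α.flatten.length := by
  induction x generalizing α with
  | nil =>
    obtain rfl : α = [] := by simpa [nonterminals] using h
    rfl
  | cons s x ih =>
    cases s with
    | terminal a =>
      have := ih h
      simp only [fill, terminals, List.length_cons]
      omega
    | nonterminal A =>
      rcases α with _ | ⟨γ, α⟩
      · simp [nonterminals] at h
      · have := ih (α := α) (by simpa [nonterminals] using h)
        simp only [fill, terminals, List.length_append, List.flatten_cons]
        omega

/-! ### Matrix grammars -/

namespace MatrixGrammar

open SententialForm

variable {T N : Type*}

/-- Productions leave terminals alone, so the whole matrix replaces each nonterminal of `x` by what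
grows out of it. The occurrences rewritten are given by their places in the sequence of
nonterminals, so the same filling is available in every form with that sequence. -/
theorem Step.exists_fill {m : List (ContextFreeRule T N)} {x z : List (Symbol T N)}
    (h : Step m x z) : ∃ α, α.length = (nonterminals x).length ∧ z = fill x α ∧
      ∀ x', nonterminals x = nonterminals x' → Step m x' (fill x' α) := by
  induction h with
  | nil x =>
    refine ⟨_, by simp, (fill_singletons x).symm, fun x' hx' => ?_⟩
    rw [hx', fill_singletons]
    exact .nil _
  | @cons p m x y z hxy _ ih =>
    obtain ⟨u, v, rfl, rfl⟩ := hxy.exists_parts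
    obtain ⟨α, hα, rfl, hstep⟩ := ih
    simp only [nonterminals_append, List.length_append] at hα
    -- The words filled into `p.output` by the later productions are gathered into one word that
    -- replaces `p.input`.
    obtain ⟨α₁, α₂, α₃, rfl, h1, h2, h3⟩ : ∃ α₁ α₂ α₃, α = α₁ ++ α₂ ++ α₃ ∧
        α₁.length = (nonterminals u).length ∧ α₂.length = (nonterminals p.output).length ∧
        α₃.length = (nonterminals v).length := by
      refine ⟨α.take (nonterminals u).length,
        (α.drop (nonterminals u).length).take (nonterminals p.output).length,
        (α.drop (nonterminals u).length).drop (nonterminals p.output).length, ?_, ?_, ?_, ?_⟩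
      · rw [List.append_assoc, List.take_append_drop, List.take_append_drop]
      all_goals simp only [List.length_take, List.length_drop]; omega
    have hfill : ∀ u' v' : List (Symbol T N), nonterminals u' = nonterminals u →
        fill (u' ++ p.output ++ v') (α₁ ++ α₂ ++ α₃) =
          fill (u' ++ [Symbol.nonterminal p.input] ++ v') (α₁ ++ [fill p.output α₂] ++ α₃) := by
      intro u' v' hu
      have h1' := h1.trans (congrArg List.length hu).symm
      rw [fill_append (by simp [nonterminals_append, h1', h2]), fill_append h1',
        fill_append (x := u' ++ [Symbol.nonterminal p.input])
          (by simp [nonterminals_append, nonterminals, h1']), fill_append h1']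
      simp [fill]
    refine ⟨α₁ ++ [fill p.output α₂] ++ α₃, ?_, hfill u v rfl, ?_⟩
    · simp [nonterminals_append, nonterminals, h1, h3]
    · intro x' hx'
      have hx'' : nonterminals x' = nonterminals u ++ p.input :: nonterminals v := by
        simpa [nonterminals_append, nonterminals] using hx'.symm
      obtain ⟨u', z', rfl, hu', hz'⟩ := nonterminals_eq_append hx''
      obtain ⟨w, v', rfl, hv'⟩ := nonterminals_eq_cons hz'
      have hu'' : nonterminals (u' ++ w.map Symbol.terminal) = nonterminals u := by
        simp [nonterminals_append, hu']
      have := hstep (u' ++ w.map Symbol.terminal ++ p.output ++ v')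
        (by rw [nonterminals_append, nonterminals_append, nonterminals_append,
          nonterminals_append, hu'', hv'])
      rw [hfill _ _ hu''] at this
      have hr := ContextFreeRule.rewrites_of_exists_parts p (u' ++ w.map Symbol.terminal) v'
      have e : u' ++ (w.map Symbol.terminal ++ Symbol.nonterminal p.input :: v') =
          u' ++ w.map Symbol.terminal ++ [Symbol.nonterminal p.input] ++ v' := by simp
      rw [e]
      exact .cons hr this

theorem Step.length_le {m : List (ContextFreeRule T N)} {x y : List (Symbol T N)}
    (h : Step m x y) : y.length ≤ x.length + (m.map fun p => p.output.length).sum := by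
  induction h with
  | nil x => simp
  | cons hxy _ ih =>
    obtain ⟨u, v, rfl, rfl⟩ := hxy.exists_parts
    simp only [List.length_append, List.map_cons, List.sum_cons, List.length_singleton] at ih ⊢
    omega

/-- A bound for the growth of sentential forms in one step. -/
def growth (G : MatrixGrammar T N) : ℕ :=
  G.rules.sup fun m => (m.map fun p => p.output.length).sum

theorem length_le_add_growth (G : MatrixGrammar T N) {m : List (ContextFreeRule T N)}
    (hm : m ∈ G.rules) {x y : List (Symbol T N)} (h : Step m x y) :
    y.length ≤ x.length + G.growth :=
  h.length_le.trans (Nat.add_le_add_left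
    (Finset.le_sup (f := fun m : List (ContextFreeRule T N) =>
      (m.map fun p => p.output.length).sum) hm) _)

theorem finite_steps [Finite T] [Finite N] (G : MatrixGrammar T N) (k : ℕ) (x : Bounded T N k) :
    {e : List (ContextFreeRule T N) × Bounded T N k | e.1 ∈ G.rules ∧ Step e.1 x.1 e.2.1}.Finite
    := by
  have := Fintype.ofFinite T
  have := Fintype.ofFinite N
  refine ((Finset.finite_toSet G.rules).prod
    ((List.finite_length_le (Symbol T N) (x.1.length + G.growth)).preimage
      Subtype.val_injective.injOn)).subset ?_
  rintro ⟨m, y⟩ ⟨hm, h⟩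
  exact ⟨hm, G.length_le_add_growth hm h⟩

/-- The steps of a matrix grammar between forms with at most `k` nonterminals. -/
noncomputable def pathSystem [Finite T] [Finite N] (G : MatrixGrammar T N) (k : ℕ) :
    PathSystem (Bounded T N k) (List (ContextFreeRule T N)) where
  out x := (G.finite_steps k x).toFinset
  wt x := (terminals x.1).length
  final := {x | nonterminals x.1 = []}

variable [Finite T] [Finite N] (G : MatrixGrammar T N) {k : ℕ}

theorem mem_out_pathSystem {x : Bounded T N k}
    {e : List (ContextFreeRule T N) × Bounded T N k} :
    e ∈ (G.pathSystem k).out x ↔ e.1 ∈ G.rules ∧ Step e.1 x.1 e.2.1 := by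
  simp [pathSystem]

/-- A filling replaces at most `k` symbols and lengthens the form by at most `G.growth`, so its
words have total length at most `k + G.growth`; two fillings are compared, whence the factor `2`. -/
theorem isBisimulation_pathSystem (k : ℕ) : (G.pathSystem k).IsBisimulation
    fun x x' => FormEquiv (2 * (k + G.growth)) x.1 x'.1 := by
  refine isBisimulation_of_fill _ (fun _ => rfl) (fun _ => Iff.rfl) _ (fun _ _ => .symm)
    (fun _ _ => FormEquiv.nonterminals_eq) (fun _ _ _ h => h.fill)
    (fun _ α => α.flatten.length ≤ k + G.growth)
    (fun x x' l α β h hα hβ h1 h2 => h.fill_eq hα hβ (by omega)) ?_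
  intro x e he
  obtain ⟨hm, hs⟩ := G.mem_out_pathSystem.1 he
  obtain ⟨α, hα, hfill, hstep⟩ := hs.exists_fill
  refine ⟨α, hα, ?_, hfill, ?_⟩
  · have h1 := G.length_le_add_growth hm hs
    have h2 := x.2
    rw [hfill, length_fill hα, ← length_terminals_add x.1, length_nonterminals] at h1
    omega
  · intro x' hx'
    have hn := hx'.nonterminals_eq
    refine ⟨⟨fill x'.1 α, ?_⟩, rfl, G.mem_out_pathSystem.2 ⟨hm, hstep _ hn⟩⟩
    have := e.2.2
    rwa [hfill, ← length_nonterminals, nonterminals_fill hα,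
      ← nonterminals_fill (hα.trans (congrArg List.length hn)), length_nonterminals] at this

theorem wt_le_wt_of_mem_out (x : Bounded T N k) :
    ∀ e ∈ (G.pathSystem k).out x, (G.pathSystem k).wt x ≤ (G.pathSystem k).wt e.2 := by
  intro e he
  obtain ⟨α, hα, hfill, _⟩ := (G.mem_out_pathSystem.1 he).2.exists_fill
  simp only [pathSystem]
  rw [hfill, length_terminals_fill hα]
  omega

theorem isDerivation_of_isPath {x : Bounded T N k}
    {d : List (List (ContextFreeRule T N) × Bounded T N k)} (h : (G.pathSystem k).IsPath x d) :
    G.IsDerivation x.1 (d.map (Prod.map id Subtype.val))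
      ((terminals (PathSystem.endpoint x d).1).map Symbol.terminal) := by
  rw [map_terminals_of_nonterminals_eq_nil h.endpoint_mem_final]
  induction d generalizing x with
  | nil => exact .nil _
  | cons e d ih =>
    obtain ⟨hm, hs⟩ := G.mem_out_pathSystem.1 h.1
    exact .cons hm hs (ih h.2)

theorem IsDerivation.exists_isPath {G : MatrixGrammar T N} {x y : List (Symbol T N)}
    {d : List (List (ContextFreeRule T N) × List (Symbol T N))} (h : G.IsDerivation x d y)
    (hx : numNonterminals x ≤ k) (hd : ∀ z ∈ d.map Prod.snd, numNonterminals z ≤ k)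
    (hy : nonterminals y = []) :
    ∃ d', (G.pathSystem k).IsPath ⟨x, hx⟩ d' ∧ (PathSystem.endpoint ⟨x, hx⟩ d').1 = y := by
  induction h with
  | nil x => exact ⟨[], hy, rfl⟩
  | @cons m x y z d hm hs _ ih =>
    obtain ⟨d', h1, h2⟩ := ih (hd _ (by simp)) (fun z hz => hd z (by simp at hz ⊢; tauto)) hy
    exact ⟨(m, _) :: d', ⟨G.mem_out_pathSystem.2 ⟨hm, hs⟩, h1⟩, h2⟩

/-- Unambiguity makes the map from paths to words injective, finite index makes it surjective. The
bound `k + 1` admits the start form even for `k = 0`. -/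
theorem isRationalSeries_generatingSeries (hu : G.IsUnambiguous) (hf : G.IsFiniteIndex) :
    IsRationalSeries (generatingSeries G.language) := by
  obtain ⟨k, hk⟩ := hf
  obtain ⟨l, σ, hl, hσ⟩ :=
    exists_finite_index_formEquiv T N (2 * (k + 1 + G.growth)) (k + 1)
  have := hl.to_subtype
  let x₀ : Bounded T N (k + 1) := ⟨[Symbol.nonterminal G.initial], by simp [numNonterminals]⟩
  refine (G.isBisimulation_pathSystem (k + 1)).isRationalSeries_generatingSeries σ hσ x₀
    G.language (fun d => terminals (PathSystem.endpoint x₀ d).1) ⟨?_, ?_, ?_⟩ ?_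
  · intro d hd
    exact ⟨_, G.isDerivation_of_isPath hd⟩
  · intro d hd d' hd' h
    have h1 := G.isDerivation_of_isPath hd
    have h2 := G.isDerivation_of_isPath hd'
    dsimp only at h
    rw [← h] at h2
    exact (List.map_injective_iff.2 (Function.injective_id.prodMap Subtype.val_injective))
      ((hu _ ⟨_, h1⟩).unique h1 h2)
  · intro w hw
    obtain ⟨d, hd, hi⟩ := hk w hw
    have hi' := numNonterminals_le_of_indexOfForms_le (hi.trans (Nat.le_succ k))
    obtain ⟨d', h1, h2⟩ := hd.exists_isPath x₀.2 (fun z hz => hi' z (List.mem_cons_of_mem _ hz))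
      (by simp)
    exact ⟨d', h1, by dsimp only; rw [h2, terminals_map_terminal]⟩
  · intro d hd
    have := hd.wt_add_pathWeight G.wt_le_wt_of_mem_out
    simp only [pathSystem, x₀, terminals, List.length_nil, zero_add] at this
    exact this.symm

end MatrixGrammar

/-! ### Reduced ET0L systems -/

namespace ReducedET0L

open SententialForm ET0LTree

variable {T V : Type*}

theorem Step.exists_fill {P : Finset (ContextFreeRule T V)} {x y : List (Symbol T V)}
    (h : Step P x y) : ∃ α,
      List.Forall₂ (fun A β => ContextFreeRule.mk A β ∈ P) (nonterminals x) α ∧ y = fill x α := by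
  induction h with
  | nil => exact ⟨[], .nil, rfl⟩
  | terminal a _ ih =>
    obtain ⟨α, h, rfl⟩ := ih
    exact ⟨α, h, rfl⟩
  | @nonterminal x y X β hX _ ih =>
    obtain ⟨α, h, rfl⟩ := ih
    exact ⟨β :: α, .cons hX h, rfl⟩

theorem step_fill {P : Finset (ContextFreeRule T V)} {x : List (Symbol T V)}
    {α : List (List (Symbol T V))}
    (h : List.Forall₂ (fun A β => ContextFreeRule.mk A β ∈ P) (nonterminals x) α) :
    Step P x (fill x α) := by
  induction x generalizing α with
  | nil => exact .nil
  | cons s x ih =>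
    cases s with
    | terminal a => exact .terminal a (ih h)
    | nonterminal A =>
      rcases h with _ | ⟨h1, h2⟩
      exact .nonterminal h1 (ih h2)

theorem finite_forall₂ (P : Finset (ContextFreeRule T V)) (s : List V) :
    {α | List.Forall₂ (fun A β => ContextFreeRule.mk A β ∈ P) s α}.Finite := by
  induction s with
  | nil => exact (Set.finite_singleton []).subset fun α hα => by simpa using hα
  | cons A s ih =>
    have h : {β | ContextFreeRule.mk A β ∈ P}.Finite :=
      P.finite_toSet.preimage (f := fun β => ContextFreeRule.mk A β)
        fun β _ β' _ h => (ContextFreeRule.mk.inj h).2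
    refine (h.image2 List.cons ih).subset ?_
    rintro _ (_ | ⟨h1, h2⟩)
    exact ⟨_, h1, _, h2, rfl⟩

theorem finite_steps (G : ReducedET0L T V) (k : ℕ) (x : Bounded T V k) :
    {e : List (List (Symbol T V)) × Bounded T V k | nonterminals x.1 ≠ [] ∧
      (∃ P ∈ G.tables, List.Forall₂ (fun A β => ContextFreeRule.mk A β ∈ P)
        (nonterminals x.1) e.1) ∧ e.2.1 = fill x.1 e.1}.Finite := by
  refine Set.Finite.of_finite_image (f := Prod.fst) ?_ ?_
  · refine (G.tables.finite_toSet.biUnion fun P _ =>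
      finite_forall₂ P (nonterminals x.1)).subset ?_
    rintro _ ⟨e, ⟨_, ⟨P, hP, h⟩, _⟩, rfl⟩
    exact Set.mem_biUnion hP h
  · rintro e ⟨_, _, h⟩ e' ⟨_, _, h'⟩ he
    exact Prod.ext he (Subtype.ext (by rw [h, h', he]))

/-- The steps of a reduced ET0L system between forms with at most `k` variables, labelled by the
right-hand sides used; forms without variables have no steps. -/
noncomputable def pathSystem (G : ReducedET0L T V) (k : ℕ) :
    PathSystem (Bounded T V k) (List (List (Symbol T V))) where
  out x := (G.finite_steps k x).toFinset
  wt x := (terminals x.1).length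
  final := {x | nonterminals x.1 = []}

variable (G : ReducedET0L T V) {k : ℕ}

theorem mem_out_pathSystem {x : Bounded T V k} {e : List (List (Symbol T V)) × Bounded T V k} :
    e ∈ (G.pathSystem k).out x ↔ nonterminals x.1 ≠ [] ∧
      (∃ P ∈ G.tables, List.Forall₂ (fun A β => ContextFreeRule.mk A β ∈ P)
        (nonterminals x.1) e.1) ∧ e.2.1 = fill x.1 e.1 := by
  simp [pathSystem]

/-- A step carries its filling as label, so different fillings never merge and the terminals are
irrelevant. -/
theorem isBisimulation_pathSystem (k : ℕ) : (G.pathSystem k).IsBisimulation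
    fun x x' => nonterminals x.1 = nonterminals x'.1 := by
  refine isBisimulation_of_fill _ (fun _ => rfl) (fun _ => Iff.rfl)
    (fun x x' => nonterminals x = nonterminals x') (fun _ _ => Eq.symm) (fun _ _ => id) ?_
    (fun l α => l = α) ?_ ?_
  · intro x x' α h hα
    rw [nonterminals_fill hα, nonterminals_fill (hα.trans (congrArg List.length h))]
  · rintro x x' l _ _ _ _ _ rfl rfl _
    rfl
  · intro x e he
    obtain ⟨h1, ⟨P, hP, h2⟩, h3⟩ := G.mem_out_pathSystem.1 he
    refine ⟨e.1, h2.length_eq.symm, rfl, h3, fun x' h => ⟨⟨fill x'.1 e.1, ?_⟩, rfl,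
      G.mem_out_pathSystem.2 ⟨h ▸ h1, ⟨P, hP, h ▸ h2⟩, rfl⟩⟩⟩
    have := e.2.2
    rwa [h3, ← length_nonterminals, nonterminals_fill h2.length_eq.symm,
      ← nonterminals_fill (h2.length_eq.symm.trans (congrArg List.length h)),
      length_nonterminals] at this

theorem wt_le_wt_of_mem_out (x : Bounded T V k) :
    ∀ e ∈ (G.pathSystem k).out x, (G.pathSystem k).wt x ≤ (G.pathSystem k).wt e.2 := by
  intro e he
  obtain ⟨_, ⟨P, _, h⟩, hfill⟩ := G.mem_out_pathSystem.1 he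
  simp only [pathSystem]
  rw [hfill, length_terminals_fill h.length_eq.symm]
  omega

theorem exists_isDerivation_of_isPath {x : Bounded T V k}
    {d : List (List (List (Symbol T V)) × Bounded T V k)} (h : (G.pathSystem k).IsPath x d) :
    ∃ d', G.IsDerivation x.1 d'
      ((terminals (PathSystem.endpoint x d).1).map Symbol.terminal) := by
  rw [map_terminals_of_nonterminals_eq_nil h.endpoint_mem_final]
  induction d generalizing x with
  | nil => exact ⟨[], .nil _⟩
  | cons e d ih =>
    obtain ⟨_, ⟨P, hP, h2⟩, h3⟩ := G.mem_out_pathSystem.1 h.1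
    obtain ⟨d', hd'⟩ := ih h.2
    have hs := step_fill h2
    rw [← h3] at hs
    exact ⟨_, .cons hP hs hd'⟩

theorem IsDerivation.exists_isPath {G : ReducedET0L T V} {x y : List (Symbol T V)}
    {d : List (List (Symbol T V))} (h : G.IsDerivation x d y)
    (hx : numNonterminals x ≤ k) (hd : ∀ z ∈ d, numNonterminals z ≤ k)
    (hy : nonterminals y = []) :
    ∃ d', (G.pathSystem k).IsPath ⟨x, hx⟩ d' ∧ (PathSystem.endpoint ⟨x, hx⟩ d').1 = y := by
  induction h with
  | nil x => exact ⟨[], hy, rfl⟩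
  | @cons P x y z d hP hs _ ih =>
    obtain ⟨d', h1, h2⟩ := ih (hd _ (by simp)) (fun z hz => hd z (by simp [hz])) hy
    obtain ⟨α, hα, rfl⟩ := hs.exists_fill
    -- A table changes nothing in a form without variables; such idle steps, invisible in the tree,
    -- are dropped.
    by_cases hn : nonterminals x = []
    · obtain ⟨w, rfl⟩ : ∃ w : List T, x = w.map Symbol.terminal :=
        ⟨_, (map_terminals_of_nonterminals_eq_nil hn).symm⟩
      simp only [fill_map_terminal] at h1 h2
      exact ⟨d', h1, h2⟩
    · exact ⟨(α, _) :: d', ⟨G.mem_out_pathSystem.2 ⟨hn, ⟨P, hP, hα⟩, rfl⟩, h1⟩, h2⟩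

/-! ### Derivation trees of paths -/

/-- The forest whose roots are the symbols of a form and whose variables are expanded by given
words with given subtrees. -/
def expand : List (Symbol T V) → List (List (Symbol T V)) → List (ET0LTree T V) →
    List (ET0LTree T V)
  | [], _, _ => []
  | Symbol.terminal a :: x, α, ts => ET0LTree.leaf a :: expand x α ts.tail
  | Symbol.nonterminal _ :: _, [], _ => []
  | Symbol.nonterminal A :: x, β :: α, ts =>
    ET0LTree.node A (ts.take β.length) :: expand x α (ts.drop β.length)

/-- The forest of a path. -/
def forest : List (Symbol T V) → List (List (List (Symbol T V)) × Bounded T V k) →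
    List (ET0LTree T V)
  | x, [] => (terminals x).map ET0LTree.leaf
  | x, e :: d => expand x e.1 (forest e.2.1 d)

theorem map_root_expand {x : List (Symbol T V)} {α : List (List (Symbol T V))}
    (hα : α.length = (nonterminals x).length) (ts : List (ET0LTree T V)) :
    (expand x α ts).map root = x := by
  induction x generalizing α ts with
  | nil => rfl
  | cons s x ih =>
    cases s with
    | terminal a => simp [expand, root, ih hα]
    | nonterminal A =>
      rcases α with _ | ⟨β, α⟩
      · simp [nonterminals] at hα
      · simp [expand, root, ih (α := α) (by simpa [nonterminals] using hα)]

theorem eq_leaf_of_root_eq {t : ET0LTree T V} {a : T} (h : t.root = Symbol.terminal a) :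
    t = ET0LTree.leaf a := by
  cases t with
  | leaf b => simpa [root] using h
  | node => simp [root] at h

theorem map_root_eq_append {ts : List (ET0LTree T V)} {β y : List (Symbol T V)}
    (h : ts.map root = β ++ y) :
    (ts.take β.length).map root = β ∧ (ts.drop β.length).map root = y := by
  rw [List.map_take, List.map_drop, h]
  simp

theorem flatten_map_yield_expand {x : List (Symbol T V)} {α : List (List (Symbol T V))}
    (hα : α.length = (nonterminals x).length) {ts : List (ET0LTree T V)}
    (hts : ts.map root = fill x α) :
    ((expand x α ts).map yield).flatten = (ts.map yield).flatten := by
  induction x generalizing α ts with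
  | nil =>
    obtain rfl : ts = [] := by simpa [fill] using hts
    rfl
  | cons s x ih =>
    cases s with
    | terminal a =>
      rcases ts with _ | ⟨t, ts⟩
      · simp [fill] at hts
      · obtain ⟨h1, h2⟩ := List.cons.inj hts
        obtain rfl := eq_leaf_of_root_eq h1
        simp [expand, ih hα h2]
    | nonterminal A =>
      rcases α with _ | ⟨β, α⟩
      · simp [nonterminals] at hα
      · have h := map_root_eq_append hts
        conv_rhs => rw [← List.take_append_drop β.length ts, List.map_append, List.flatten_append]
        simp [expand, yield, ih (α := α) (by simpa [nonterminals] using hα) h.2]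

theorem follows_expand {P : Finset (ContextFreeRule T V)} {Ps : List (Finset (ContextFreeRule T V))}
    {x : List (Symbol T V)} {α : List (List (Symbol T V))}
    (hα : List.Forall₂ (fun A β => ContextFreeRule.mk A β ∈ P) (nonterminals x) α)
    {ts : List (ET0LTree T V)} (hts : ts.map root = fill x α) (hP : ∀ t ∈ ts, Follows Ps t) :
    ∀ t ∈ expand x α ts, Follows (P :: Ps) t := by
  induction x generalizing α ts with
  | nil => simp [expand]
  | cons s x ih =>
    cases s with
    | terminal a =>
      rcases ts with _ | ⟨t, ts⟩
      · simp [fill] at hts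
      · intro t' ht'
        rcases List.mem_cons.1 ht' with rfl | ht'
        · exact .leaf _ _
        · exact ih hα (List.cons.inj hts).2 (fun t ht => hP t (List.mem_cons_of_mem _ ht)) t' ht'
    | nonterminal A =>
      rcases hα with _ | ⟨h1, h2⟩
      have h := map_root_eq_append hts
      intro t' ht'
      rcases List.mem_cons.1 ht' with rfl | ht'
      · exact .node (by rwa [h.1]) fun t ht => hP t (List.mem_of_mem_take ht)
      · exact ih h2 h.2 (fun t ht => hP t (List.mem_of_mem_drop ht)) t' ht'

/-- The roots of the children of a node spell the word that replaced its variable, so the tree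
reveals the filling. -/
theorem expand_injective {x : List (Symbol T V)} {α β : List (List (Symbol T V))}
    (hα : α.length = (nonterminals x).length) (hβ : β.length = (nonterminals x).length)
    {ts us : List (ET0LTree T V)} (hts : ts.map root = fill x α) (hus : us.map root = fill x β)
    (h : expand x α ts = expand x β us) : α = β ∧ ts = us := by
  induction x generalizing α β ts us with
  | nil =>
    obtain rfl : ts = [] := by simpa [fill] using hts
    obtain rfl : us = [] := by simpa [fill] using hus
    obtain rfl : α = [] := by simpa [nonterminals] using hα
    obtain rfl : β = [] := by simpa [nonterminals] using hβ
    exact ⟨rfl, rfl⟩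
  | cons s x ih =>
    cases s with
    | terminal a =>
      rcases ts with _ | ⟨t, ts⟩
      · simp [fill] at hts
      rcases us with _ | ⟨u, us⟩
      · simp [fill] at hus
      obtain ⟨h1, h2⟩ := List.cons.inj hts
      obtain ⟨h3, h4⟩ := List.cons.inj hus
      obtain ⟨rfl, rfl⟩ := ih hα hβ h2 h4 (List.cons.inj h).2
      rw [eq_leaf_of_root_eq h1, eq_leaf_of_root_eq h3]
      exact ⟨rfl, rfl⟩
    | nonterminal A =>
      rcases α with _ | ⟨γ, α⟩
      · simp [nonterminals] at hα
      rcases β with _ | ⟨γ', β⟩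
      · simp [nonterminals] at hβ
      obtain ⟨h1, h2⟩ := map_root_eq_append hts
      obtain ⟨h3, h4⟩ := map_root_eq_append hus
      obtain ⟨h5, h6⟩ := List.cons.inj h
      have h5 := (ET0LTree.node.inj h5).2
      obtain rfl : γ = γ' := by rw [← h1, h5, h3]
      obtain ⟨rfl, h7⟩ := ih (by simpa [nonterminals] using hα)
        (by simpa [nonterminals] using hβ) h2 h4 h6
      refine ⟨rfl, ?_⟩
      rw [← List.take_append_drop γ.length ts, h5, h7, List.take_append_drop]

variable {G} {x : Bounded T V k} {d : List (List (List (Symbol T V)) × Bounded T V k)}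

theorem map_root_forest (h : (G.pathSystem k).IsPath x d) : (forest x.1 d).map root = x.1 := by
  rcases d with _ | ⟨e, d⟩
  · conv_rhs => rw [← map_terminals_of_nonterminals_eq_nil h]
    simp [forest, root, Function.comp_def]
  · obtain ⟨_, ⟨P, _, h2⟩, _⟩ := G.mem_out_pathSystem.1 h.1
    exact map_root_expand h2.length_eq.symm _

theorem flatten_map_yield_forest (h : (G.pathSystem k).IsPath x d) :
    ((forest x.1 d).map yield).flatten = terminals (PathSystem.endpoint x d).1 := by
  induction d generalizing x with
  | nil =>
    simp only [forest, PathSystem.endpoint, List.map_map]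
    induction terminals x.1 with
    | nil => rfl
    | cons a w ih => simpa [yield] using ih
  | cons e d ih =>
    obtain ⟨_, ⟨P, _, h2⟩, h3⟩ := G.mem_out_pathSystem.1 h.1
    rw [forest, flatten_map_yield_expand h2.length_eq.symm (by rw [map_root_forest h.2, h3]),
      ih h.2, PathSystem.endpoint]

theorem exists_follows_forest (h : (G.pathSystem k).IsPath x d) :
    ∃ Ps : List (Finset (ContextFreeRule T V)), (∀ P ∈ Ps, P ∈ G.tables) ∧
      ∀ t ∈ forest x.1 d, Follows Ps t := by
  induction d generalizing x with
  | nil =>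
    refine ⟨[], by simp, fun t ht => ?_⟩
    obtain ⟨a, _, rfl⟩ := List.mem_map.1 ht
    exact .leaf _ _
  | cons e d ih =>
    obtain ⟨_, ⟨P, hP, h2⟩, h3⟩ := G.mem_out_pathSystem.1 h.1
    obtain ⟨Ps, hPs, hf⟩ := ih h.2
    refine ⟨P :: Ps, ?_, follows_expand h2 (by rw [map_root_forest h.2, h3]) hf⟩
    simpa using ⟨hP, hPs⟩

/-- The fillings are read off level by level. Paths of different length cannot share a forest, since
a path stops exactly when no variables are left. -/
theorem forest_injective (h : (G.pathSystem k).IsPath x d)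
    {d' : List (List (List (Symbol T V)) × Bounded T V k)} (h' : (G.pathSystem k).IsPath x d')
    (heq : forest x.1 d = forest x.1 d') : d = d' := by
  induction d generalizing x d' with
  | nil =>
    rcases d' with _ | ⟨e', d'⟩
    · rfl
    · exact absurd h (G.mem_out_pathSystem.1 h'.1).1
  | cons e d ih =>
    obtain ⟨h1, ⟨P, _, h2⟩, h3⟩ := G.mem_out_pathSystem.1 h.1
    rcases d' with _ | ⟨e', d'⟩
    · exact absurd h' h1
    · obtain ⟨_, ⟨P', _, h2'⟩, h3'⟩ := G.mem_out_pathSystem.1 h'.1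
      obtain ⟨h4, h5⟩ := expand_injective h2.length_eq.symm h2'.length_eq.symm
        (by rw [map_root_forest h.2, h3]) (by rw [map_root_forest h'.2, h3']) heq
      obtain rfl : e = e' := Prod.ext h4 (Subtype.ext (by rw [h3, h3', h4]))
      rw [ih h.2 h'.2 h5]

theorem exists_forest_eq_singleton {X : V} (hx : x.1 = [Symbol.nonterminal X])
    (h : (G.pathSystem k).IsPath x d) : ∃ t, forest x.1 d = [t] ∧ t.root = Symbol.nonterminal X := by
  have := map_root_forest h
  conv at this => rhs; rw [hx]
  obtain ⟨t, ht, hr⟩ := List.map_eq_singleton_iff.1 this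
  exact ⟨t, ht, hr⟩

/-! ### Rationality for reduced ET0L systems -/

variable (G)

theorem isRationalSeries_generatingSeries [Finite T] [Finite V] (hu : G.IsUnambiguous)
    (hf : G.IsFiniteIndex) : IsRationalSeries (generatingSeries G.language) := by
  obtain ⟨k, hk⟩ := hf
  let x₀ : Bounded T V (k + 1) := ⟨[Symbol.nonterminal G.initial], by simp [numNonterminals]⟩
  have hfin : Finite {s : List V // s.length ≤ k + 1} := by
    have := Fintype.ofFinite V
    exact List.finite_length_le V (k + 1)
  refine (G.isBisimulation_pathSystem (k + 1)).isRationalSeries_generatingSeries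
    (Q := {s : List V // s.length ≤ k + 1})
    (fun x => ⟨nonterminals x.1, (length_nonterminals x.1).trans_le x.2⟩)
    (fun x x' h => Subtype.ext_iff.1 h) x₀
    G.language (fun d => terminals (PathSystem.endpoint x₀ d).1) ⟨?_, ?_, ?_⟩ ?_
  · intro d hd
    exact G.exists_isDerivation_of_isPath hd
  · intro d hd d' hd' h
    -- Unambiguity speaks of trees, so paths with the same word are compared through their forests,
    -- which consist of a single tree.
    have key : ∀ d, (G.pathSystem (k + 1)).IsPath x₀ d → ∃ t, forest x₀.1 d = [t] ∧
        G.IsDerivationTreeOf t (terminals (PathSystem.endpoint x₀ d).1) := by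
      intro d hd
      obtain ⟨t, ht, hr⟩ := exists_forest_eq_singleton (X := G.initial) rfl hd
      have hy := flatten_map_yield_forest hd
      obtain ⟨Ps, hPs, hF⟩ := exists_follows_forest hd
      refine ⟨t, ht, hr, ?_, Ps, hPs, hF t (by simp [ht])⟩
      rw [← hy, ht]
      simp
    obtain ⟨t, ht, h1⟩ := key d hd
    obtain ⟨t', ht', h2⟩ := key d' hd'
    dsimp only at h
    rw [← h] at h2
    refine forest_injective hd hd' ?_
    rw [ht, ht', (hu _ (G.exists_isDerivation_of_isPath hd)).unique h1 h2]
  · intro w hw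
    obtain ⟨d, hd, hi⟩ := hk w hw
    have hi' := numNonterminals_le_of_indexOfForms_le (hi.trans (Nat.le_succ k))
    obtain ⟨d', h1, h2⟩ := hd.exists_isPath x₀.2 (fun z hz => hi' z (List.mem_cons_of_mem _ hz))
      (by simp)
    exact ⟨d', h1, by dsimp only; rw [h2, terminals_map_terminal]⟩
  · intro d hd
    have := hd.wt_add_pathWeight G.wt_le_wt_of_mem_out
    simp only [pathSystem, x₀, terminals, List.length_nil, zero_add] at this
    exact this.symm

end ReducedET0L

theorem mainTheorem5 {T : Type*} [Finite T] :
    (∀ (N : Type*) [Finite N] (G : MatrixGrammar T N), G.IsUnambiguous → G.IsFiniteIndex →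
      IsRationalSeries (generatingSeries G.language) ∧ IsCountingRegular G.language) ∧
    (∀ (V : Type*) [Finite V] (G : ReducedET0L T V), G.IsUnambiguous → G.IsFiniteIndex →
      IsRationalSeries (generatingSeries G.language) ∧ IsCountingRegular G.language) := by
  exact ⟨fun N _ G hu hf =>
      ⟨G.isRationalSeries_generatingSeries hu hf,
        (G.isRationalSeries_generatingSeries hu hf).isCountingRegular⟩,
    fun V _ G hu hf =>
      ⟨G.isRationalSeries_generatingSeries hu hf,
        (G.isRationalSeries_generatingSeries hu hf).isCountingRegular⟩⟩
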